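/- Let $X$ be a metric space with its Borel $\sigma$-algebra, $\mu$ a Borel probability measure on $X$ and $T:X\to X$ a measurable map preserving $\mu$. Assume super-polynomial decay of correlations: there is a sequence $(\theta_n)_{n\ge1}$ with $\lim_{n\to\infty}\theta_n n^p=0$ for all $p>0$ such that, for all bounded Lipschitz $\psi:X\to\mathbb R$, all bounded measurable $\varphi:X\to\mathbb R$ and all $n\ge 1$, $$\Big|\int_X\psi\cdot\varphi\circ T^n\,d\mu-\int_X\psi\,d\mu\int_X\varphi\,d\mu\Big|\le\|\psi\|_{\mathrm{Lip}}\,\|\varphi\|_\infty\,\theta_n ,$$ where $\|\psi\|_{\mathrm{Lip}}=\|\psi\|_\infty+|\psi|_{\mathrm{Lip}}$, $|\psi|_{\mathrm{Lip}}$ is the best Lipschitz constant of $\psi$, and $\|\cdot\|_\infty$ is the supremum norm. Let $f:X\to\mathbb R^N$ be Lipschitz such that $$\mu\big(\{x\in X:\ \exists n\ge1,\ f(T^nx)=f(x)\}\big)=0 .$$ Write $f_*\mu(A)=\mu(f^{-1}A)$ and let $B(y,r)$ be the open Euclidean ball of centre $y$ and radius $r$. Assume that for $f_*\mu$-almost every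 $y\in\mathbb R^N$ there exist $a>0$ and $b\ge0$ such that $$f_*\mu\big(B(y,r)\setminus B(y,r-\rho)\big)\le r^{-b}\rho^{a}$$ for all sufficiently small $r>0$ and all $0<\rho<r$. For $x,x_0\in X$ and $r>0$ put $$\tau^f_r(x,x_0)=\inf\{k\ge1:\ f(T^kx)\in B(f(x_0),r)\}\in\{1,2,\dots\}\cup\{\infty\},$$ and let $$\underline d_{f_*\mu}(y)=\liminf_{r\to0^+}\frac{\log f_*\mu(B(y,r))}{\log r}\qquad\text{(with } \log 0=-\infty\text{)}.$$ Then for every $t\ge0$ and for $\mu$-almost every $x_0\in X$ such that $\underline d_{f_*\mu}(f(x_0))>0$, $$\lim_{r\to0^+}\mu\Big(\Big\{x\in X:\ \tau^f_r(x,x_0)>\frac{t}{f_*\mu(B(f(x_0),r))}\Big\}\Big)=e^{-t}$$ and $$\lim_{r\to0^+}\mu_{f^{-1}B(f(x_0),r)}\Big(\Big\{x\in X:\ \tau^f_r(x,x_0)>\frac{t}{f_*\mu(B(f(x_0),r))}\Big\}\Big)=e^{-t},$$ where $\mu_A(B)=\mu(A\cap B)/\mu(A)$. -/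

import Mathlib

open MeasureTheory Filter Topology
open scoped ENNReal

noncomputable section

namespace ObsHitting

/-- The hitting time for the observation `f` (under iteration of `T`) of the set `A`:
`inf {k ≥ 1 : f (T^k x) ∈ A}`, equal to `∞` when there is no such `k`. -/
def hittingTime {X Y : Type*} (T : X → X) (f : X → Y) (A : Set Y) (x : X) : ℕ∞ :=
  ⨅ (k : ℕ) (_ : 1 ≤ k ∧ f (T^[k] x) ∈ A), (k : ℕ∞)

/-- `μ`-almost aperiodicity for the observation `f`: almost no point has its observation
repeated exactly along its orbit. -/
def AlmostAperiodic {X Y : Type*} [MeasurableSpace X] (μ : Measure X) (T : X → X)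
    (f : X → Y) : Prop :=
  μ {x | ∃ n : ℕ, 1 ≤ n ∧ f (T^[n] x) = f x} = 0

/-- The lower local dimension `liminf_{r → 0+} log ν(B(y,r)) / log r`, with values in the
extended reals (with `log 0 = -∞`, so it is `+∞` at points outside the support of `ν`). -/
def lowerLocalDim {Y : Type*} [PseudoMetricSpace Y] [MeasurableSpace Y] (ν : Measure Y)
    (y : Y) : EReal :=
  liminf (fun r : ℝ => ENNReal.log (ν (Metric.ball y r)) / ((Real.log r : ℝ) : EReal)) (𝓝[>] 0)

/-- The supremum norm of a bounded function. -/
def supNorm {X : Type*} (φ : X → ℝ) : ℝ := ⨆ x, |φ x|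

/-- The best Lipschitz constant of a Lipschitz function. -/
def lipConst {X : Type*} [PseudoMetricSpace X] (ψ : X → ℝ) : ℝ :=
  sInf {K : ℝ | 0 ≤ K ∧ ∀ x y, |ψ x - ψ y| ≤ K * dist x y}

/-- The Lipschitz norm of a bounded Lipschitz function. -/
def lipNorm {X : Type*} [PseudoMetricSpace X] (ψ : X → ℝ) : ℝ := supNorm ψ + lipConst ψ

/-- Super-polynomial decay of correlations, Lipschitz against bounded measurable observables.
The Lipschitz norm is infinite on unbounded functions, for which the estimate is void, so the
Lipschitz observables range over the bounded ones. -/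
def SuperPolyDecay {X : Type*} [PseudoMetricSpace X] [MeasurableSpace X] (μ : Measure X)
    (T : X → X) : Prop :=
  ∃ θ : ℕ → ℝ,
    (∀ p : ℝ, 0 < p → Tendsto (fun n : ℕ => θ n * (n : ℝ) ^ p) atTop (𝓝 0)) ∧
    ∀ ψ φ : X → ℝ,
      (∃ K, LipschitzWith K ψ) → (∃ C, ∀ x, |ψ x| ≤ C) →
      Measurable φ → (∃ C, ∀ x, |φ x| ≤ C) →
      ∀ n : ℕ, 1 ≤ n →
        |∫ x, ψ x * φ (T^[n] x) ∂μ - (∫ x, ψ x ∂μ) * ∫ x, φ x ∂μ|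
          ≤ lipNorm ψ * supNorm φ * θ n

/-- The annulus condition: for `ν`-a.e. `y` there are `a > 0`, `b ≥ 0` such that
`ν(B(y,r) \ B(y,r-ρ)) ≤ r^{-b} ρ^a` for all small `r > 0` and all `0 < ρ < r`. -/
def AnnulusCondition {Y : Type*} [PseudoMetricSpace Y] [MeasurableSpace Y]
    (ν : Measure Y) : Prop :=
  ∀ᵐ y ∂ν, ∃ a b : ℝ, 0 < a ∧ 0 ≤ b ∧ ∃ r₀ : ℝ, 0 < r₀ ∧
    ∀ r ρ : ℝ, 0 < ρ → ρ < r → r < r₀ →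
      ν (Metric.ball y r \ Metric.ball y (r - ρ)) ≤ ENNReal.ofReal (r ^ (-b) * ρ ^ a)

end ObsHitting

end

/-! Write `A` for the preimage under `f` of a ball of radius `r`. By invariance, the probability of
avoiding `A` up to time `n + 1` is that of avoiding it up to time `n`, minus the measure of the
points of `A` that avoid it up to time `n`. If hitting and return laws differ by at most `ε`
uniformly in time, this recursion forces the hitting law within `ε` of the geometric law `(1 - μ A)
^ n`, which at time `t / μ A` tends to `exp (-t)`; the return law then follows
(`tendsto_avoid_exp`).

To compare the two laws, leave a gap of length `n = ⌊r ^ (-δ)⌋₊` (`abs_avoid_mul_sub_inter_le`).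
Relative to `μ A`, the discrepancy is a mixing error, plus the conditional probability of returning
within the gap, plus `n * μ A`. The last term vanishes for small `δ` because the lower dimension is
positive. The mixing error is handled by Lipschitz cutoffs: the annulus condition pays for the
smoothing, super-polynomial decay beats the Lipschitz norm, and almost everywhere balls have measure
at least a constant times their volume (`exists_mixing_rate`).

Short returns are the main difficulty. Where the image measure has a uniform power upper bound,
averaging over centres bounds the measure of near returns at time `k`; Borel–Cantelli and
aperiodicity then give `dist (f (T^[k] x)) (f x) ≥ c * k ^ (-p)` for all `k ≥ 1`, with `c` depending
on `x` (`ae_exists_le_dist`). Points with small `c` have small density in balls around almost every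
centre, and for `p * δ < 1` a short return to a small ball forces `c` to be small
(`ae_tendsto_short_return`). -/

namespace ObsHitting

/-- The points whose orbit avoids `A` at all times `1, …, n`. -/
def avoid {X : Type*} (T : X → X) (A : Set X) (n : ℕ) : Set X :=
  {x | ∀ k, 1 ≤ k → k ≤ n → T^[k] x ∉ A}

/-! ### Combinatorics of orbits avoiding a set. -/

section Avoid

variable {X : Type*} {T : X → X} {A : Set X}

lemma avoid_zero : avoid T A 0 = Set.univ := by
  ext x
  simp only [avoid, Set.mem_ofPred_eq, Set.mem_univ, iff_true]
  intro k h1 h2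
  omega

lemma avoid_add (n m : ℕ) : avoid T A (n + m) = avoid T A n ∩ T^[n] ⁻¹' avoid T A m := by
  ext x
  simp only [avoid, Set.mem_ofPred_eq, Set.mem_inter_iff, Set.mem_preimage]
  constructor
  · intro h
    refine ⟨fun k h1 h2 => h k h1 (by omega), fun k h1 h2 => ?_⟩
    rw [← Function.iterate_add_apply]
    exact h _ (by omega) (by omega)
  · rintro ⟨h, h'⟩ k h1 h2
    rcases le_or_gt k n with hk | hk
    · exact h k h1 hk
    · have := h' (k - n) (by omega) (by omega)
      rwa [← Function.iterate_add_apply, Nat.sub_add_cancel hk.le] at this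

lemma avoid_one : avoid T A 1 = T ⁻¹' Aᶜ := by
  ext x
  simp only [avoid, Set.mem_ofPred_eq, Set.mem_preimage, Set.mem_compl_iff]
  constructor
  · intro h
    exact h 1 le_rfl le_rfl
  · intro h k h1 h2
    obtain rfl : k = 1 := by omega
    exact h

lemma avoid_succ (n : ℕ) : avoid T A (n + 1) = T ⁻¹' (avoid T A n \ A) := by
  rw [add_comm, avoid_add, avoid_one]
  ext x
  simp [and_comm]

lemma avoid_anti {m n : ℕ} (h : m ≤ n) : avoid T A n ⊆ avoid T A m :=
  fun _ hx k h1 h2 => hx k h1 (h2.trans h)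

lemma compl_avoid_subset (n : ℕ) :
    (avoid T A n)ᶜ ⊆ ⋃ k ∈ Finset.Icc 1 n, T^[k] ⁻¹' A := by
  intro x hx
  simp only [avoid, Set.mem_compl_iff, Set.mem_ofPred_eq, not_forall, not_not] at hx
  obtain ⟨k, h1, h2, h3⟩ := hx
  simp only [Set.mem_iUnion]
  exact ⟨k, Finset.mem_Icc.2 ⟨h1, h2⟩, h3⟩

/-- A hitting time is an integer or infinite, so a finite real threshold may be replaced by its
floor. -/
lemma setOf_lt_hittingTime {Y : Type*} (f : X → Y) (B : Set Y) {u : ℝ≥0∞} (hu : u ≠ ∞) :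
    {x | u < (hittingTime T f B x : ℝ≥0∞)} = avoid T (f ⁻¹' B) ⌊u.toReal⌋₊ := by
  ext x
  have key : u < (hittingTime T f B x : ℝ≥0∞) ↔ (⌊u.toReal⌋₊ : ℕ∞) < hittingTime T f B x := by
    induction hittingTime T f B x using ENat.recTopCoe with
    | top => simp [hu.lt_top]
    | coe k =>
      rw [ENat.toENNReal_coe, Nat.cast_lt, Nat.floor_lt ENNReal.toReal_nonneg,
        ← ENNReal.toReal_natCast k, ENNReal.toReal_lt_toReal hu (ENNReal.natCast_ne_top k)]
  simp only [Set.mem_ofPred_eq, key, avoid, Set.mem_preimage]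
  rw [← not_le, ← not_iff_not, not_not]
  push Not
  constructor
  · intro h
    by_contra! hc
    have : ((⌊u.toReal⌋₊ + 1 : ℕ) : ℕ∞) ≤ hittingTime T f B x := by
      refine le_iInf₂ fun k hk => ?_
      rw [Nat.cast_le]
      by_contra! hlt
      exact hc k hk.1 (by omega) hk.2
    have := this.trans h
    rw [Nat.cast_le] at this
    omega
  · rintro ⟨k, h1, h2, h3⟩
    exact (iInf₂_le k ⟨h1, h3⟩).trans (by exact_mod_cast h2)

end Avoid

/-! ### Hitting versus return laws for a single set. -/

section Measure

variable {X : Type*} [MeasurableSpace X] {μ : Measure X} {T : X → X} {A : Set X}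

lemma measurableSet_avoid (hT : Measurable T) (hA : MeasurableSet A) (n : ℕ) :
    MeasurableSet (avoid T A n) := by
  induction n with
  | zero => rw [avoid_zero]; exact .univ
  | succ n ih => rw [avoid_succ]; exact hT (ih.diff hA)

lemma measureReal_compl_avoid_le [IsFiniteMeasure μ] (hT : MeasurePreserving T μ μ)
    (hA : MeasurableSet A) (n : ℕ) : μ.real (avoid T A n)ᶜ ≤ n * μ.real A := by
  calc μ.real (avoid T A n)ᶜ ≤ μ.real (⋃ k ∈ Finset.Icc 1 n, T^[k] ⁻¹' A) :=
        measureReal_mono (compl_avoid_subset n) (measure_ne_top _ _)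
    _ ≤ ∑ k ∈ Finset.Icc 1 n, μ.real (T^[k] ⁻¹' A) := measureReal_biUnion_finset_le _ _
    _ = n * μ.real A := by
        simp [measureReal_def, (hT.iterate _).measure_preimage hA.nullMeasurableSet]

lemma measureReal_avoid_succ [IsFiniteMeasure μ] (hT : MeasurePreserving T μ μ)
    (hA : MeasurableSet A) (n : ℕ) :
    μ.real (avoid T A (n + 1)) = μ.real (avoid T A n) - μ.real (A ∩ avoid T A n) := by
  have h := measurableSet_avoid hT.measurable hA n
  rw [avoid_succ, measureReal_def, hT.measure_preimage (h.diff hA).nullMeasurableSet,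
    ← measureReal_def, ← measureReal_inter_add_sdiff (s := avoid T A n) hA, Set.inter_comm A]
  ring

/-- The law of the hitting time is geometric up to the discrepancy between the hitting and the
return time distributions. -/
lemma abs_measureReal_avoid_sub_pow_le [IsProbabilityMeasure μ] (hT : MeasurePreserving T μ μ)
    (hA : MeasurableSet A) {ε : ℝ}
    (hε : ∀ j, |μ.real (avoid T A j) * μ.real A - μ.real (A ∩ avoid T A j)| ≤ ε * μ.real A)
    (hε0 : 0 ≤ ε) (n : ℕ) : |μ.real (avoid T A n) - (1 - μ.real A) ^ n| ≤ ε := by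
  induction n with
  | zero => simpa [avoid_zero] using hε0
  | succ n ih =>
    have h1 : μ.real A ≤ 1 := measureReal_le_one
    have h0 : 0 ≤ μ.real A := measureReal_nonneg
    rw [measureReal_avoid_succ hT hA]
    -- The old error contracts by `1 - μ A` and a new error of at most `ε * μ A` enters, so the
    -- bound `ε` is reproduced exactly.
    have e : μ.real (avoid T A n) - μ.real (A ∩ avoid T A n) - (1 - μ.real A) ^ (n + 1)
        = (1 - μ.real A) * (μ.real (avoid T A n) - (1 - μ.real A) ^ n)
          + (μ.real (avoid T A n) * μ.real A - μ.real (A ∩ avoid T A n)) := by ring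
    rw [e]
    refine (abs_add_le _ _).trans ?_
    rw [abs_mul, abs_of_nonneg (sub_nonneg.2 h1)]
    have := mul_le_mul_of_nonneg_left ih (sub_nonneg.2 h1)
    linarith [hε n]

/-- Comparison of the hitting and return time distributions through a mixing gap of length `n`. -/
lemma abs_avoid_mul_sub_inter_le [IsProbabilityMeasure μ] (hT : MeasurePreserving T μ μ)
    (hA : MeasurableSet A) {n : ℕ} {κ : ℝ}
    (hκ : ∀ S, MeasurableSet S → |μ.real (A ∩ T^[n] ⁻¹' S) - μ.real A * μ.real S| ≤ κ) (j : ℕ) :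
    |μ.real (avoid T A j) * μ.real A - μ.real (A ∩ avoid T A j)|
      ≤ κ + μ.real (A \ avoid T A n) + n * μ.real A * μ.real A := by
  have hκ0 : 0 ≤ κ := (abs_nonneg _).trans (hκ _ .univ)
  have hm := measurableSet_avoid hT.measurable hA
  have h0 : 0 ≤ μ.real A := measureReal_nonneg
  have hc := measureReal_compl_avoid_le hT hA n
  have hd0 : 0 ≤ μ.real (A \ avoid T A n) := measureReal_nonneg
  -- For `j ≤ n` both terms are close to `μ A`. For `j > n` the conditions at times `1, …, n` are
  -- dropped from both: this costs `n * μ A * μ A` in one and the short returns in the other, and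
  -- mixing compares what remains.
  rcases le_or_gt j n with hj | hj
  · have a1 : μ.real (avoid T A j) ≤ 1 := measureReal_le_one
    have a2 : 1 - n * μ.real A ≤ μ.real (avoid T A j) := by
      have := measureReal_mono (μ := μ) (avoid_anti (T := T) (A := A) hj)
      rw [probReal_compl_eq_one_sub (hm n)] at hc
      linarith
    have a3 : μ.real (A ∩ avoid T A j) ≤ μ.real A := measureReal_mono Set.inter_subset_left
    have a4 : μ.real A - μ.real (A \ avoid T A n) ≤ μ.real (A ∩ avoid T A j) := by
      have := measureReal_inter_add_sdiff (μ := μ) (s := A) (hm n)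
      have := measureReal_mono (μ := μ)
        (Set.inter_subset_inter_right A (avoid_anti (T := T) (A := A) hj))
      linarith
    have a5 := mul_le_mul_of_nonneg_right a1 h0
    have a6 := mul_le_mul_of_nonneg_right a2 h0
    rw [abs_le]
    constructor <;> nlinarith
  · obtain ⟨i, rfl⟩ := Nat.exists_eq_add_of_le hj.le
    set S := avoid T A i
    have hS : MeasurableSet S := hm i
    have hSn : MeasurableSet (T^[n] ⁻¹' S) := (hT.iterate n).measurable hS
    have e : avoid T A (n + i) = avoid T A n ∩ T^[n] ⁻¹' S := avoid_add n i
    have k1 : μ.real (T^[n] ⁻¹' S) = μ.real S := by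
      rw [measureReal_def, (hT.iterate n).measure_preimage hS.nullMeasurableSet, measureReal_def]
    have b1 : μ.real (avoid T A (n + i)) ≤ μ.real S := by
      rw [e, ← k1]; exact measureReal_mono Set.inter_subset_right
    have b2 : μ.real S - n * μ.real A ≤ μ.real (avoid T A (n + i)) := by
      rw [e, ← k1]
      have h1 := measureReal_inter_add_sdiff (μ := μ) (s := T^[n] ⁻¹' S) (hm n)
      have h2 : μ.real (T^[n] ⁻¹' S \ avoid T A n) ≤ μ.real (avoid T A n)ᶜ :=
        measureReal_mono fun x hx => hx.2
      rw [Set.inter_comm]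
      linarith
    have b3 : μ.real (A ∩ avoid T A (n + i)) ≤ μ.real (A ∩ T^[n] ⁻¹' S) := by
      rw [e]; exact measureReal_mono fun x hx => ⟨hx.1, hx.2.2⟩
    have b4 : μ.real (A ∩ T^[n] ⁻¹' S) - μ.real (A \ avoid T A n)
        ≤ μ.real (A ∩ avoid T A (n + i)) := by
      have h1 := measureReal_inter_add_sdiff (μ := μ) (s := A ∩ T^[n] ⁻¹' S) (hm n)
      have h2 : μ.real ((A ∩ T^[n] ⁻¹' S) \ avoid T A n) ≤ μ.real (A \ avoid T A n) :=
        measureReal_mono fun x hx => ⟨hx.1.1, hx.2⟩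
      have h3 : (A ∩ T^[n] ⁻¹' S) ∩ avoid T A n = A ∩ avoid T A (n + i) := by
        rw [e]; ext x; simp only [Set.mem_inter_iff]; tauto
      rw [h3] at h1
      linarith
    have hk := abs_le.1 (hκ S hS)
    have a5 := mul_le_mul_of_nonneg_right b1 h0
    have a6 := mul_le_mul_of_nonneg_right b2 h0
    rw [abs_le]
    constructor <;> nlinarith [hk.1, hk.2]

end Measure

/-! ### From geometric to exponential laws. -/

lemma tendsto_one_sub_pow_floor_div {ι : Type*} {l : Filter ι} {a : ι → ℝ}
    (ha : Tendsto a l (𝓝[>] 0)) {t : ℝ} (ht : 0 ≤ t) :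
    Tendsto (fun i => (1 - a i) ^ ⌊t / a i⌋₊) l (𝓝 (Real.exp (-t))) := by
  suffices h : Tendsto (fun a : ℝ => (1 - a) ^ ⌊t / a⌋₊) (𝓝[>] 0) (𝓝 (Real.exp (-t))) from
    h.comp ha
  have h1 : Tendsto (fun a : ℝ => a⁻¹ * Real.log (1 - a)) (𝓝[>] 0) (𝓝 (-1)) := by
    have hd : HasDerivAt (fun a : ℝ => Real.log (1 - a)) (-1) 0 := by
      have := ((hasDerivAt_id (0 : ℝ)).const_sub 1).log (by simp)
      simpa using this
    have := hd.tendsto_slope_zero_right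
    simpa using this
  have h2 : Tendsto (fun a : ℝ => (⌊t / a⌋₊ : ℝ) * a) (𝓝[>] 0) (𝓝 t) := by
    have l1 : Tendsto (fun a : ℝ => t - a) (𝓝[>] 0) (𝓝 t) := by
      have : Tendsto (fun a : ℝ => t - a) (𝓝 0) (𝓝 (t - 0)) :=
        (continuous_const.sub continuous_id).tendsto 0
      rw [sub_zero] at this
      exact this.mono_left nhdsWithin_le_nhds
    refine tendsto_of_tendsto_of_tendsto_of_le_of_le' l1 tendsto_const_nhds ?_ ?_
    · filter_upwards [self_mem_nhdsWithin] with a (ha : 0 < a)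
      have := (Nat.lt_floor_add_one (t / a)).le
      have := mul_le_mul_of_nonneg_right this ha.le
      rw [div_mul_cancel₀ _ ha.ne'] at this
      linarith
    · filter_upwards [self_mem_nhdsWithin] with a (ha : 0 < a)
      have := mul_le_mul_of_nonneg_right (Nat.floor_le (div_nonneg ht ha.le)) ha.le
      rwa [div_mul_cancel₀ _ ha.ne'] at this
  -- The power is the exponential of `(⌊t / a⌋₊ * a) * (log (1 - a) / a)`, whose factors tend to `t`
  -- and `-1`.
  have h3 := (Real.continuous_exp.tendsto _).comp (h2.mul h1)
  rw [mul_neg_one] at h3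
  refine h3.congr' ?_
  filter_upwards [Ioo_mem_nhdsGT (zero_lt_one (α := ℝ))] with a ha
  have hpos : 0 < 1 - a := by linarith [ha.2]
  have : (⌊t / a⌋₊ : ℝ) * a * (a⁻¹ * Real.log (1 - a)) = ⌊t / a⌋₊ * Real.log (1 - a) := by
    field_simp [ha.1.ne']
  simp only [Function.comp_apply, this]
  rw [Real.exp_nat_mul, Real.exp_log hpos]

/-- Exponential laws for hitting and return times to shrinking sets, from mixing and from the
rarity of short returns. -/
theorem tendsto_avoid_exp {X ι : Type*} [MeasurableSpace X] {μ : Measure X}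
    [IsProbabilityMeasure μ] {T : X → X} (hT : MeasurePreserving T μ μ) {l : Filter ι}
    {A : ι → Set X} (hA : ∀ i, MeasurableSet (A i)) {n : ι → ℕ} {κ : ι → ℝ}
    (hA0 : Tendsto (fun i => μ.real (A i)) l (𝓝[>] 0))
    (hκ : ∀ᶠ i in l, ∀ S, MeasurableSet S →
      |μ.real (A i ∩ T^[n i] ⁻¹' S) - μ.real (A i) * μ.real S| ≤ κ i)
    (hκ0 : Tendsto (fun i => κ i / μ.real (A i)) l (𝓝 0))
    (hshort : Tendsto (fun i => μ.real (A i \ avoid T (A i) (n i)) / μ.real (A i)) l (𝓝 0))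
    (hn : Tendsto (fun i => n i * μ.real (A i)) l (𝓝 0)) {t : ℝ} (ht : 0 ≤ t) :
    Tendsto (fun i => μ.real (avoid T (A i) ⌊t / μ.real (A i)⌋₊)) l (𝓝 (Real.exp (-t))) ∧
    Tendsto (fun i => (ProbabilityTheory.cond μ (A i)).real
      (avoid T (A i) ⌊t / μ.real (A i)⌋₊)) l (𝓝 (Real.exp (-t))) := by
  have hpos : ∀ᶠ i in l, 0 < μ.real (A i) := hA0.eventually self_mem_nhdsWithin
  set ε : ι → ℝ := fun i => κ i / μ.real (A i)
    + μ.real (A i \ avoid T (A i) (n i)) / μ.real (A i) + n i * μ.real (A i) with hεdef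
  have hε : Tendsto ε l (𝓝 0) := by simpa using (hκ0.add hshort).add hn
  have hb : ∀ᶠ i in l, ∀ j, |μ.real (avoid T (A i) j) * μ.real (A i)
      - μ.real (A i ∩ avoid T (A i) j)| ≤ ε i * μ.real (A i) := by
    filter_upwards [hpos, hκ] with i hi hκi j
    refine (abs_avoid_mul_sub_inter_le hT (hA i) hκi j).trans (le_of_eq ?_)
    simp only [hεdef]
    field_simp
  have first : Tendsto (fun i => μ.real (avoid T (A i) ⌊t / μ.real (A i)⌋₊)) l
      (𝓝 (Real.exp (-t))) := by
    have h := tendsto_one_sub_pow_floor_div hA0 ht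
    refine (tendsto_iff_of_dist ?_).1 h
    refine squeeze_zero' (.of_forall fun _ => dist_nonneg) ?_ hε
    filter_upwards [hpos, hb] with i hi hbi
    have hε0 : 0 ≤ ε i := by
      have := (abs_nonneg _).trans (hbi 0)
      exact nonneg_of_mul_nonneg_left this hi
    rw [dist_comm, Real.dist_eq]
    exact abs_measureReal_avoid_sub_pow_le hT (hA i) hbi hε0 _
  refine ⟨first, ?_⟩
  refine (tendsto_iff_of_dist ?_).1 first
  refine squeeze_zero' (.of_forall fun _ => dist_nonneg) ?_ hε
  filter_upwards [hpos, hb] with i hi hbi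
  rw [Real.dist_eq, measureReal_def (ProbabilityTheory.cond μ (A i)), ProbabilityTheory.cond_apply (hA i),
    ENNReal.toReal_mul, ENNReal.toReal_inv, ← measureReal_def, ← measureReal_def]
  refine le_of_mul_le_mul_right (le_of_eq_of_le ?_ (hbi ⌊t / μ.real (A i)⌋₊)) hi
  rw [← abs_of_pos hi, ← abs_mul, abs_of_pos hi, sub_mul, mul_right_comm, inv_mul_cancel₀ hi.ne',
    one_mul]

/-! ### Lipschitz cutoffs of balls. -/

/-- A Lipschitz cutoff, equal to `1` on the ball of radius `a` and to `0` outside the ball of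
radius `a + w`. -/
noncomputable def cutoff {Y : Type*} [PseudoMetricSpace Y] (z : Y) (a w : ℝ) (y : Y) : ℝ :=
  max 0 (min 1 ((a + w - dist y z) / w))

section Cutoff

variable {Y : Type*} [PseudoMetricSpace Y] {z : Y} {a w : ℝ}

lemma cutoff_mem_Icc (y : Y) : cutoff z a w y ∈ Set.Icc (0 : ℝ) 1 :=
  ⟨le_max_left _ _, max_le zero_le_one (min_le_left _ _)⟩

lemma cutoff_eq_one (hw : 0 < w) {y : Y} (hy : dist y z ≤ a) : cutoff z a w y = 1 := by
  have : 1 ≤ (a + w - dist y z) / w := by rw [le_div_iff₀ hw]; linarith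
  simp [cutoff, min_eq_left this]

lemma cutoff_eq_zero (hw : 0 < w) {y : Y} (hy : a + w ≤ dist y z) : cutoff z a w y = 0 := by
  have : (a + w - dist y z) / w ≤ 0 := div_nonpos_of_nonpos_of_nonneg (by linarith) hw.le
  exact max_eq_left ((min_le_right _ _).trans this)

lemma lipschitzWith_cutoff (hw : 0 < w) :
    LipschitzWith (Real.toNNReal w⁻¹) (cutoff z a w : Y → ℝ) := by
  have h : LipschitzWith (Real.toNNReal w⁻¹) (fun y : Y => (a + w - dist y z) / w) := by
    refine LipschitzWith.of_dist_le_mul fun x y => ?_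
    rw [Real.coe_toNNReal _ (inv_nonneg.2 hw.le), Real.dist_eq, ← sub_div, abs_div, abs_of_pos hw,
      div_eq_inv_mul]
    refine mul_le_mul_of_nonneg_left ?_ (inv_nonneg.2 hw.le)
    rw [sub_sub_sub_cancel_left, abs_sub_comm]
    exact abs_dist_sub_le x y z
  exact (h.const_min 1).const_max 0

lemma lipschitzWith_cutoff_comp {X : Type*} [PseudoMetricSpace X] {f : X → Y} {K : ℝ}
    (hf : LipschitzWith (Real.toNNReal K) f) (hw : 0 < w) :
    LipschitzWith (Real.toNNReal (K / w)) (fun x => cutoff z a w (f x)) := by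
  rw [div_eq_inv_mul, Real.toNNReal_mul (inv_nonneg.2 hw.le)]
  exact (lipschitzWith_cutoff hw).comp hf

end Cutoff

/-! ### Decay of correlations for balls. -/

section Mixing

variable {X : Type*} [MetricSpace X] [MeasurableSpace X] {μ : Measure X}
  [IsProbabilityMeasure μ] {T : X → X}

/-- `θ` bounds the correlations of Lipschitz functions with values in `[0, 1]` and measurable
sets. -/
def CorrelationBound (μ : Measure X) (T : X → X) (θ : ℕ → ℝ) : Prop :=
  ∀ (ψ : X → ℝ) (L : ℝ), 0 ≤ L → LipschitzWith (Real.toNNReal L) ψ →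
    (∀ x, ψ x ∈ Set.Icc (0 : ℝ) 1) → ∀ S, MeasurableSet S → ∀ n, 1 ≤ n →
    |∫ x in T^[n] ⁻¹' S, ψ x ∂μ - (∫ x, ψ x ∂μ) * μ.real S| ≤ (1 + L) * θ n

/-- Testing against indicators suffices later. Passing to `|θ n|` allows the exact norms to be
replaced by the upper bound `1 + L`. -/
lemma SuperPolyDecay.exists_correlationBound (hT : Measurable T) (h : SuperPolyDecay μ T) :
    ∃ θ : ℕ → ℝ, (∀ n, 0 ≤ θ n) ∧
      (∀ p : ℝ, 0 < p → Tendsto (fun n : ℕ => θ n * (n : ℝ) ^ p) atTop (𝓝 0)) ∧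
      CorrelationBound μ T θ := by
  obtain ⟨θ, h0, h1⟩ := h
  refine ⟨fun n => |θ n|, fun _ => abs_nonneg _, fun p hp => ?_, ?_⟩
  · have := (h0 p hp).abs
    rw [abs_zero] at this
    refine this.congr fun n => ?_
    rw [abs_mul, abs_of_nonneg (Real.rpow_nonneg (Nat.cast_nonneg n) p)]
  · intro ψ L hL0 hL hψ S hS n hn
    have : Nonempty X := nonempty_of_isProbabilityMeasure μ
    have hψabs : ∀ x, |ψ x| ≤ 1 := fun x => by
      rw [abs_of_nonneg (hψ x).1]; exact (hψ x).2
    have hφabs : ∀ x, |S.indicator (1 : X → ℝ) x| ≤ 1 := fun x => by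
      by_cases hx : x ∈ S <;> simp [hx]
    have key := h1 ψ (S.indicator 1) ⟨_, hL⟩ ⟨1, hψabs⟩ (measurable_one.indicator hS)
      ⟨1, hφabs⟩ n hn
    have e1 : ∫ x, ψ x * S.indicator (1 : X → ℝ) (T^[n] x) ∂μ = ∫ x in T^[n] ⁻¹' S, ψ x ∂μ := by
      rw [← integral_indicator (hT.iterate n hS)]
      congr 1
      ext x
      by_cases hx : T^[n] x ∈ S
      · rw [Set.indicator_of_mem hx, Set.indicator_of_mem (show x ∈ T^[n] ⁻¹' S from hx)]
        simp
      · rw [Set.indicator_of_notMem hx, Set.indicator_of_notMem (show x ∉ T^[n] ⁻¹' S from hx)]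
        simp
    rw [e1, integral_indicator_one hS] at key
    refine key.trans ?_
    have s1 : supNorm ψ ≤ 1 := ciSup_le hψabs
    have s1' : 0 ≤ supNorm ψ := Real.iSup_nonneg fun _ => abs_nonneg _
    have s2 : supNorm (S.indicator (1 : X → ℝ)) ≤ 1 := ciSup_le hφabs
    have s2' : 0 ≤ supNorm (S.indicator (1 : X → ℝ)) := Real.iSup_nonneg fun _ => abs_nonneg _
    have s3 : lipConst ψ ≤ L := by
      refine csInf_le ⟨0, fun K hK => hK.1⟩ ⟨hL0, fun x y => ?_⟩
      have := hL.dist_le_mul x y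
      rwa [Real.dist_eq, Real.coe_toNNReal _ hL0] at this
    have s3' : 0 ≤ lipConst ψ := Real.sInf_nonneg fun K hK => hK.1
    have s4 : lipNorm ψ * supNorm (S.indicator (1 : X → ℝ)) ≤ (1 + L) * 1 :=
      mul_le_mul (add_le_add s1 s3) s2 s2' (by linarith)
    rw [mul_one] at s4
    calc _ ≤ lipNorm ψ * supNorm (S.indicator (1 : X → ℝ)) * |θ n| :=
          mul_le_mul_of_nonneg_left (le_abs_self _) (mul_nonneg (add_nonneg s1' s3') s2')
      _ ≤ _ := mul_le_mul_of_nonneg_right s4 (abs_nonneg _)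

lemma integrable_cutoff_comp [BorelSpace X] {Y : Type*} [PseudoMetricSpace Y] {f : X → Y}
    (hf : Continuous f) (z : Y) (a : ℝ) {w : ℝ} (hw : 0 < w) :
    Integrable (fun x => cutoff z a w (f x)) μ := by
  have hm : Measurable fun x => cutoff z a w (f x) :=
    ((lipschitzWith_cutoff hw).continuous.comp hf).measurable
  refine Integrable.of_bound hm.aestronglyMeasurable 1 (.of_forall fun x => ?_)
  rw [Real.norm_eq_abs, abs_of_nonneg (cutoff_mem_Icc _).1]
  exact (cutoff_mem_Icc _).2

variable [BorelSpace X] {Y : Type*} [PseudoMetricSpace Y] [MeasurableSpace Y] [BorelSpace Y]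
  {f : X → Y} {K : ℝ} {θ : ℕ → ℝ}

lemma measureReal_inter_le_setIntegral_cutoff (hf : Continuous f) (z : Y) (a : ℝ) {w : ℝ}
    (hw : 0 < w) (S : Set X) :
    μ.real (f ⁻¹' Metric.ball z a ∩ S) ≤ ∫ x in S, cutoff z a w (f x) ∂μ := by
  have hB : MeasurableSet (f ⁻¹' Metric.ball z a) := hf.measurable Metric.isOpen_ball.measurableSet
  have : μ.real (f ⁻¹' Metric.ball z a ∩ S)
      = ∫ x in S, (f ⁻¹' Metric.ball z a).indicator (1 : X → ℝ) x ∂μ := by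
    rw [integral_indicator_one hB, measureReal_restrict_apply hB]
  rw [this]
  refine setIntegral_mono ((integrable_const (1 : ℝ)).indicator hB).integrableOn
    (integrable_cutoff_comp hf z a hw).integrableOn fun x => ?_
  refine Set.indicator_le' (fun x hx => ?_) (fun x _ => (cutoff_mem_Icc _).1) x
  exact (cutoff_eq_one hw (Metric.mem_ball.1 hx).le).ge

lemma setIntegral_cutoff_le_measureReal_inter (hf : Continuous f) (z : Y) (a : ℝ) {w : ℝ}
    (hw : 0 < w) (S : Set X) :
    ∫ x in S, cutoff z a w (f x) ∂μ ≤ μ.real (f ⁻¹' Metric.ball z (a + w) ∩ S) := by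
  have hB : MeasurableSet (f ⁻¹' Metric.ball z (a + w)) :=
    hf.measurable Metric.isOpen_ball.measurableSet
  have : μ.real (f ⁻¹' Metric.ball z (a + w) ∩ S)
      = ∫ x in S, (f ⁻¹' Metric.ball z (a + w)).indicator (1 : X → ℝ) x ∂μ := by
    rw [integral_indicator_one hB, measureReal_restrict_apply hB]
  rw [this]
  refine setIntegral_mono (integrable_cutoff_comp hf z a hw).integrableOn
    ((integrable_const (1 : ℝ)).indicator hB).integrableOn fun x => ?_
  by_cases hx : x ∈ f ⁻¹' Metric.ball z (a + w)
  · rw [Set.indicator_of_mem hx]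
    exact (cutoff_mem_Icc _).2
  · rw [Set.indicator_of_notMem hx]
    exact (cutoff_eq_zero hw (not_lt.1 hx)).le

/-- Upper bound for correlations of balls with arbitrary sets. -/
lemma CorrelationBound.measureReal_inter_le (h : CorrelationBound μ T θ) (hK : 0 ≤ K) (hf : LipschitzWith (Real.toNNReal K) f) (z : Y) (a : ℝ) {w : ℝ} (hw : 0 < w)
    {S : Set X} (hS : MeasurableSet S) {n : ℕ} (hn : 1 ≤ n) :
    μ.real (f ⁻¹' Metric.ball z a ∩ T^[n] ⁻¹' S)
      ≤ μ.real (f ⁻¹' Metric.ball z (a + w)) * μ.real S + (1 + K / w) * θ n := by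
  have h1 := measureReal_inter_le_setIntegral_cutoff (μ := μ) hf.continuous z a hw
    (T^[n] ⁻¹' S)
  have h2 := setIntegral_cutoff_le_measureReal_inter (μ := μ) hf.continuous z a hw
    Set.univ
  rw [Set.inter_univ, setIntegral_univ] at h2
  have h3 := (abs_le.1 (h _ _ (div_nonneg hK hw.le) (lipschitzWith_cutoff_comp (z := z) (a := a) hf hw)
    (fun x => cutoff_mem_Icc _) S hS n hn)).2
  have h4 := mul_le_mul_of_nonneg_right h2 (measureReal_nonneg (μ := μ) (s := S))
  linarith

/-- Mixing of balls against arbitrary sets, with an error controlled by the measure of an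
annulus. -/
lemma CorrelationBound.abs_measureReal_inter_sub_le (h : CorrelationBound μ T θ)
    (hK : 0 ≤ K) (hf : LipschitzWith (Real.toNNReal K) f) (y : Y) (r : ℝ)
    {ρ : ℝ} (hρ : 0 < ρ) {S : Set X} (hS : MeasurableSet S) {n : ℕ} (hn : 1 ≤ n) :
    |μ.real (f ⁻¹' Metric.ball y r ∩ T^[n] ⁻¹' S) - μ.real (f ⁻¹' Metric.ball y r) * μ.real S|
      ≤ (μ.map f).real (Metric.ball y r \ Metric.ball y (r - ρ)) + (1 + K / ρ) * θ n := by
  have hfm : Measurable f := hf.continuous.measurable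
  have hball : ∀ s, MeasurableSet (f ⁻¹' Metric.ball y s) :=
    fun s => hfm Metric.isOpen_ball.measurableSet
  have hann : (μ.map f).real (Metric.ball y r \ Metric.ball y (r - ρ))
      = μ.real (f ⁻¹' Metric.ball y r \ f ⁻¹' Metric.ball y (r - ρ)) := by
    rw [map_measureReal_apply hfm
      (Metric.isOpen_ball.measurableSet.diff Metric.isOpen_ball.measurableSet), Set.preimage_sdiff]
  rw [hann]
  have hle : ∀ S, μ.real (f ⁻¹' Metric.ball y r ∩ S) ≤ μ.real (f ⁻¹' Metric.ball y (r - ρ) ∩ S)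
      + μ.real (f ⁻¹' Metric.ball y r \ f ⁻¹' Metric.ball y (r - ρ)) := fun S => by
    refine (measureReal_mono ?_).trans (measureReal_union_le _ _)
    rintro x ⟨h1, h2⟩
    by_cases hx : x ∈ f ⁻¹' Metric.ball y (r - ρ)
    · exact .inl ⟨hx, h2⟩
    · exact .inr ⟨h1, hx⟩
  -- The cutoff lies between the indicators of the balls of radii `r - ρ` and `r`, so each
  -- replacement of the ball by the cutoff costs at most the annulus.
  have u1 := measureReal_inter_le_setIntegral_cutoff (μ := μ) hf.continuous y (r - ρ) hρ
    (T^[n] ⁻¹' S)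
  have u2 := setIntegral_cutoff_le_measureReal_inter (μ := μ) hf.continuous y (r - ρ) hρ
    (T^[n] ⁻¹' S)
  have v1 := measureReal_inter_le_setIntegral_cutoff (μ := μ) hf.continuous y (r - ρ) hρ
    Set.univ
  have v2 := setIntegral_cutoff_le_measureReal_inter (μ := μ) hf.continuous y (r - ρ) hρ
    Set.univ
  rw [Set.inter_univ, setIntegral_univ, sub_add_cancel] at v2
  rw [Set.inter_univ, setIntegral_univ] at v1
  rw [sub_add_cancel] at u2
  have w1 := hle (T^[n] ⁻¹' S)
  have w2 := hle Set.univ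
  rw [Set.inter_univ, Set.inter_univ] at w2
  have h3 := abs_le.1 (h _ _ (div_nonneg hK hρ.le)
    (lipschitzWith_cutoff_comp (z := y) (a := r - ρ) hf hρ) (fun x => cutoff_mem_Icc _) S hS n hn)
  have hS0 : 0 ≤ μ.real S := measureReal_nonneg
  have hS1 : μ.real S ≤ 1 := measureReal_le_one
  have hA0 : 0 ≤ μ.real (f ⁻¹' Metric.ball y r \ f ⁻¹' Metric.ball y (r - ρ)) := measureReal_nonneg
  have x1 := mul_le_mul_of_nonneg_right v2 hS0
  have x2 := mul_le_mul_of_nonneg_right (w2.trans (add_le_add_left v1 _)) hS0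
  have x3 := mul_le_mul_of_nonneg_left hS1 hA0
  rw [abs_le]
  constructor <;> nlinarith [h3.1, h3.2]

end Mixing

/-! ### Super-polynomial decay along powers of the radius. -/

section Rates

lemma tendsto_natFloor_rpow_neg {δ : ℝ} (hδ : 0 < δ) :
    Tendsto (fun r : ℝ => ⌊r ^ (-δ)⌋₊) (𝓝[>] 0) atTop :=
  tendsto_nat_floor_atTop.comp (tendsto_rpow_neg_nhdsGT_zero (neg_lt_zero.2 hδ))

lemma tendsto_rpow_nhdsGT_zero' {c : ℝ} (hc : 0 < c) :
    Tendsto (fun r : ℝ => r ^ c) (𝓝[>] 0) (𝓝 0) := by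
  have := (Real.continuousAt_rpow_const 0 c (.inr hc.le)).tendsto
  rw [Real.zero_rpow hc.ne'] at this
  exact this.mono_left nhdsWithin_le_nhds

/-- A super-polynomially decaying sequence, evaluated at a negative power of `r`, decays faster
than any power of `r`. -/
lemma tendsto_rpow_neg_mul_superPoly {θ : ℕ → ℝ} (hθ0 : ∀ n, 0 ≤ θ n)
    (hθ : ∀ p : ℝ, 0 < p → Tendsto (fun n : ℕ => θ n * (n : ℝ) ^ p) atTop (𝓝 0))
    {δ D : ℝ} (hδ : 0 < δ) (hD : 0 < D) :
    Tendsto (fun r : ℝ => r ^ (-D) * θ ⌊r ^ (-δ)⌋₊) (𝓝[>] 0) (𝓝 0) := by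
  have h1 := ((hθ (D / δ) (by positivity)).comp (tendsto_natFloor_rpow_neg hδ)).const_mul
    ((2 : ℝ) ^ (D / δ))
  rw [mul_zero] at h1
  refine squeeze_zero' ?_ ?_ h1
  · filter_upwards [self_mem_nhdsWithin] with r (hr : 0 < r)
    exact mul_nonneg (Real.rpow_nonneg hr.le _) (hθ0 _)
  · filter_upwards [self_mem_nhdsWithin,
      (tendsto_natFloor_rpow_neg hδ).eventually_ge_atTop 1] with r (hr : 0 < r) hn
    have hn' : (1 : ℝ) ≤ (⌊r ^ (-δ)⌋₊ : ℝ) := by exact_mod_cast hn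
    -- Once the floor is at least `1`, a number is at most twice its floor; this is the origin of
    -- the factor `2 ^ (D / δ)`.
    have : r ^ (-D) ≤ (2 : ℝ) ^ (D / δ) * (⌊r ^ (-δ)⌋₊ : ℝ) ^ (D / δ) := by
      rw [← Real.mul_rpow (by norm_num) (by positivity)]
      have e : r ^ (-D) = (r ^ (-δ)) ^ (D / δ) := by
        rw [← Real.rpow_mul hr.le]; congr 1; field_simp
      rw [e]
      refine Real.rpow_le_rpow (Real.rpow_nonneg hr.le _) ?_ (by positivity)
      have := Nat.lt_floor_add_one (r ^ (-δ))
      linarith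
    calc _ ≤ (2 : ℝ) ^ (D / δ) * (⌊r ^ (-δ)⌋₊ : ℝ) ^ (D / δ) * θ ⌊r ^ (-δ)⌋₊ :=
          mul_le_mul_of_nonneg_right this (hθ0 _)
      _ = _ := by simp only [Function.comp_apply]; ring

end Rates

/-! ### Polynomial lower bounds on return distances. -/

section ShortReturns

variable {X : Type*} [MetricSpace X] [MeasurableSpace X] [BorelSpace X] {μ : Measure X}
  [IsProbabilityMeasure μ] {T : X → X} {E : Type*} [NormedAddCommGroup E] [InnerProductSpace ℝ E]
  [FiniteDimensional ℝ E] [MeasurableSpace E] [BorelSpace E] {f : X → E} {K : ℝ} {θ : ℕ → ℝ}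

-- Fubini and translation invariance of volume: each `x` contributes the volume of a ball of radius
-- `s`. Averaging over centres with this identity takes the place of a covering argument.
omit [MetricSpace X] [BorelSpace X] [IsProbabilityMeasure μ] in
lemma lintegral_measure_dist_lt [SFinite μ] (hf : Measurable f) (s : ℝ) :
    ∫⁻ z, μ {x | dist (f x) z < s} = μ Set.univ * volume (Metric.ball (0 : E) s) := by
  have hm : MeasurableSet {q : E × X | dist (f q.2) q.1 < s} :=
    measurableSet_lt ((hf.comp measurable_snd).dist measurable_fst) measurable_const
  have h1 := Measure.prod_apply (μ := (volume : Measure E)) (ν := μ) hm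
  have h2 := Measure.prod_apply_symm (μ := (volume : Measure E)) (ν := μ) hm
  have e : ∀ x, volume ((fun z => (z, x)) ⁻¹' {q : E × X | dist (f q.2) q.1 < s})
      = volume (Metric.ball (0 : E) s) := fun x => by
    rw [← Measure.addHaar_ball_center volume (f x) s]
    congr 1
    ext z
    simp [Metric.mem_ball, dist_comm]
  simp only [e, lintegral_const] at h2
  rw [mul_comm, ← h2, h1]
  rfl

/-- Measure of the points with observation in a set `F` returning `s`-close at time `n`. -/
lemma CorrelationBound.measureReal_near_return_le (h : CorrelationBound μ T θ)
    (hθ0 : ∀ n, 0 ≤ θ n) (hT : Measurable T) (hK : 0 ≤ K)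
    (hf : LipschitzWith (Real.toNNReal K) f) {F : Set E} {R M s : ℝ} (hM : 0 ≤ M) (hs : 0 < s)
    (hs1 : s ≤ 1) (hR : 0 ≤ R) (hFR : ∀ y ∈ F, ‖y‖ ≤ R)
    (hF : ∀ y ∈ F, (μ.map f).real (Metric.ball y (4 * s)) ≤ M) {n : ℕ} (hn : 1 ≤ n) :
    μ.real {x | f x ∈ F ∧ dist (f (T^[n] x)) (f x) < s}
      ≤ 3 ^ Module.finrank ℝ E * M
        + (R + 2) ^ Module.finrank ℝ E * ((1 + K / s) * θ n) / s ^ Module.finrank ℝ E := by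
  have hfm : Measurable f := hf.continuous.measurable
  set d := Module.finrank ℝ E
  set D : Set X := {x | f x ∈ Metric.thickening s F ∧ dist (f (T^[n] x)) (f x) < s} with hD
  have hDm : MeasurableSet D := (hfm Metric.isOpen_thickening.measurableSet).inter
    (measurableSet_lt ((hfm.comp (hT.iterate n)).dist hfm) measurable_const)
  have hsub : {x | f x ∈ F ∧ dist (f (T^[n] x)) (f x) < s} ⊆ D := fun x hx =>
    ⟨Metric.self_subset_thickening hs F hx.1, hx.2⟩
  set c : ℝ := (1 + K / s) * θ n with hc
  have hc0 : 0 ≤ c := mul_nonneg (by positivity) (hθ0 n)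
  -- A contributing centre `z` is within `2 * s` of some `y ∈ F`, so its ball of radius `2 * s` lies
  -- in the ball of radius `4 * s` about `y` and has measure at most `M`. The points counted lie in
  -- that ball at times `0` and `n`; smoothing by width `s` gives the radius `3 * s`.
  have hpt : ∀ z : E, (μ.restrict D) {x | dist (f x) z < s}
      ≤ ENNReal.ofReal M * μ {x | dist (f x) z < 3 * s}
        + (Metric.ball (0 : E) (R + 2)).indicator (fun _ => ENNReal.ofReal c) z := by
    intro z
    rw [Measure.restrict_apply (measurableSet_lt (hfm.dist measurable_const) measurable_const)]
    rcases Set.eq_empty_or_nonempty ({x | dist (f x) z < s} ∩ D) with he | ⟨x₁, hx₁, hx₁D⟩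
    · rw [he, measure_empty]; exact zero_le
    obtain ⟨y, hyF, hy⟩ := Metric.mem_thickening_iff.1 hx₁D.1
    have hzy : dist z y < 2 * s := by
      have := dist_triangle z (f x₁) y
      rw [dist_comm z (f x₁)] at this
      have : dist (f x₁) z < s := hx₁
      linarith
    have hz : z ∈ Metric.ball (0 : E) (R + 2) := by
      rw [mem_ball_zero_iff]
      have h1 := hFR y hyF
      have h2 : ‖z‖ ≤ ‖z - y‖ + ‖y‖ := by simpa using norm_add_le (z - y) y
      rw [← dist_eq_norm] at h2
      linarith
    have hball : MeasurableSet (f ⁻¹' Metric.ball z (2 * s)) :=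
      hfm Metric.isOpen_ball.measurableSet
    have key := h.measureReal_inter_le hK hf z (2 * s) hs hball hn
    have hM' : μ.real (f ⁻¹' Metric.ball z (2 * s)) ≤ M := by
      refine le_trans ?_ (hF y hyF)
      rw [map_measureReal_apply hfm Metric.isOpen_ball.measurableSet]
      refine measureReal_mono (Set.preimage_mono (Metric.ball_subset_ball' ?_))
      linarith
    have e3 : (2 * s + s) = 3 * s := by ring
    rw [e3] at key
    have key2 : μ.real (f ⁻¹' Metric.ball z (2 * s) ∩ T^[n] ⁻¹' (f ⁻¹' Metric.ball z (2 * s)))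
        ≤ M * μ.real {x | dist (f x) z < 3 * s} + c := by
      refine key.trans (add_le_add_left ?_ _)
      rw [mul_comm]
      exact mul_le_mul_of_nonneg_right hM' measureReal_nonneg
    rw [Set.indicator_of_mem hz]
    have hsub2 : {x | dist (f x) z < s} ∩ D
        ⊆ f ⁻¹' Metric.ball z (2 * s) ∩ T^[n] ⁻¹' (f ⁻¹' Metric.ball z (2 * s)) := by
      rintro x ⟨hx, hxD⟩
      have h1 : dist (f x) z < s := hx
      have h2 : dist (f (T^[n] x)) (f x) < s := hxD.2
      refine ⟨?_, ?_⟩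
      · show dist (f x) z < 2 * s
        linarith
      · show dist (f (T^[n] x)) z < 2 * s
        linarith [dist_triangle (f (T^[n] x)) (f x) z]
    refine (measure_mono hsub2).trans ?_
    rw [← ofReal_measureReal, ← ofReal_measureReal (s := {x | dist (f x) z < 3 * s}),
      ← ENNReal.ofReal_mul hM, ← ENNReal.ofReal_add (mul_nonneg hM measureReal_nonneg) hc0]
    exact ENNReal.ofReal_le_ofReal key2
  -- Integrating over `z` and cancelling the volume of the unit ball leaves the powers `s ^ d`, `(3
  -- * s) ^ d` and `(R + 2) ^ d`.
  have hint := lintegral_mono (μ := (volume : Measure E)) hpt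
  have hmeas : Measurable fun z : E => μ {x | dist (f x) z < 3 * s} := by
    have hm : MeasurableSet {q : E × X | dist (f q.2) q.1 < 3 * s} :=
      measurableSet_lt ((hfm.comp measurable_snd).dist measurable_fst) measurable_const
    exact measurable_measure_prodMk_left hm
  rw [lintegral_add_left (hmeas.const_mul _), lintegral_const_mul _ hmeas,
    lintegral_measure_dist_lt hfm, lintegral_measure_dist_lt hfm,
    lintegral_indicator_const Metric.isOpen_ball.measurableSet, Measure.restrict_apply_univ,
    measure_univ, one_mul, Measure.addHaar_ball_of_pos _ _ hs,
    Measure.addHaar_ball_of_pos _ _ (by positivity : 0 < 3 * s),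
    Measure.addHaar_ball_of_pos _ _ (by positivity : 0 < R + 2), ← mul_assoc, ← mul_assoc,
    ← mul_assoc, ← add_mul] at hint
  have hv0 : volume (Metric.ball (0 : E) 1) ≠ 0 := (Metric.measure_ball_pos _ _ one_pos).ne'
  have hv1 : volume (Metric.ball (0 : E) 1) ≠ ∞ := measure_ball_lt_top.ne
  rw [ENNReal.mul_le_mul_iff_left hv0 hv1, ← ofReal_measureReal,
    ← ENNReal.ofReal_mul measureReal_nonneg, ← ENNReal.ofReal_mul hM, ← ENNReal.ofReal_mul hc0,
    ← ENNReal.ofReal_add (by positivity) (by positivity),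
    ENNReal.ofReal_le_ofReal_iff (by positivity)] at hint
  refine (measureReal_mono hsub).trans ?_
  rw [← mul_le_mul_iff_left₀ (by positivity : 0 < s ^ d), add_mul, div_mul_cancel₀ _ (by positivity)]
  refine hint.trans (le_of_eq ?_)
  rw [mul_pow]
  ring

lemma exists_pos_le_of_eventually_one_le {g : ℕ → ℝ} (hg : ∀ k, 1 ≤ k → 0 < g k)
    (h : ∀ᶠ k in atTop, 1 ≤ g k) : ∃ c : ℝ, 0 < c ∧ ∀ k, 1 ≤ k → c ≤ g k := by
  obtain ⟨m, hm⟩ := eventually_atTop.1 h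
  have : ∀ i : ℕ, ∃ c : ℝ, 0 < c ∧ c ≤ 1 ∧ ∀ k, 1 ≤ k → k < i → c ≤ g k := by
    intro i
    induction i with
    | zero => exact ⟨1, one_pos, le_rfl, fun k _ h => absurd h (by omega)⟩
    | succ i ih =>
      obtain ⟨c, hc, hc1, hck⟩ := ih
      rcases Nat.eq_zero_or_pos i with rfl | hi
      · exact ⟨c, hc, hc1, fun k h1 h2 => absurd h2 (by omega)⟩
      refine ⟨min c (g i), lt_min hc (hg i hi), (min_le_left _ _).trans hc1, fun k h1 h2 => ?_⟩
      rcases Nat.lt_succ_iff_lt_or_eq.1 h2 with h3 | rfl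
      · exact (min_le_left _ _).trans (hck k h1 h3)
      · exact min_le_right _ _
  obtain ⟨c, hc, hc1, hck⟩ := this m
  exact ⟨c, hc, fun k h1 => (lt_or_ge k m).elim (hck k h1) fun h => hc1.trans (hm k h)⟩

/-- Almost every orbit returns to its starting observation at most polynomially fast. -/
lemma CorrelationBound.ae_exists_le_dist (h : CorrelationBound μ T θ)
    (hθ0 : ∀ n, 0 ≤ θ n)
    (hθ : ∀ p : ℝ, 0 < p → Tendsto (fun n : ℕ => θ n * (n : ℝ) ^ p) atTop (𝓝 0))
    (hT : Measurable T) (hK : 0 ≤ K) (hf : LipschitzWith (Real.toNNReal K) f)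
    (haper : AlmostAperiodic μ T f) {F : Set E} {R C a s₀ : ℝ} (hC : 0 ≤ C) (ha : 0 < a)
    (hs₀ : 0 < s₀) (hR : 0 ≤ R) (hFR : ∀ y ∈ F, ‖y‖ ≤ R)
    (hF : ∀ y ∈ F, ∀ s, 0 < s → s < s₀ → (μ.map f).real (Metric.ball y s) ≤ C * s ^ a) :
    ∀ᵐ x ∂μ, f x ∈ F → ∃ c : ℝ, 0 < c ∧ ∀ k : ℕ, 1 ≤ k →
      c * (k : ℝ) ^ (-(2 / a)) ≤ dist (f (T^[k] x)) (f x) := by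
  set d := Module.finrank ℝ E
  -- With `s k = k ^ (-p)`, the measure bound gives `s k ^ a = k ^ (-2)`, which is summable. Below,
  -- `P` absorbs `k ^ p` from the Lipschitz constant and `k ^ (p * d)` from the volume, and still
  -- leaves `k ^ (-2)`.
  set p := 2 / a with hp
  have hp0 : 0 < p := by positivity
  set s : ℕ → ℝ := fun k => (k : ℝ) ^ (-p) with hsdef
  have hs_tendsto : Tendsto s atTop (𝓝 0) :=
    (tendsto_rpow_neg_atTop hp0).comp tendsto_natCast_atTop_atTop
  set P : ℝ := p * (d + 1) + 2 with hP
  have hP0 : 0 < P := by positivity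
  have hbound : ∀ᶠ k : ℕ in atTop, ‖μ.real {x | f x ∈ F ∧ dist (f (T^[k] x)) (f x) < s k}‖
      ≤ (3 ^ d * C * 4 ^ a + (R + 2) ^ d * (1 + K)) * (k : ℝ) ^ (-2 : ℝ) := by
    filter_upwards [eventually_ge_atTop 1,
      hs_tendsto.eventually_lt_const (by positivity : (0 : ℝ) < s₀ / 4),
      (hθ P hP0).eventually_le_const (zero_lt_one' ℝ)] with k hk1 hk2 hk3
    have hk0 : (0 : ℝ) < k := by exact_mod_cast hk1
    have hk1' : (1 : ℝ) ≤ k := by exact_mod_cast hk1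
    have hsk : 0 < s k := Real.rpow_pos_of_pos hk0 _
    have hsk1 : s k ≤ 1 := Real.rpow_le_one_of_one_le_of_nonpos hk1' (by linarith)
    rw [Real.norm_of_nonneg measureReal_nonneg]
    refine (h.measureReal_near_return_le hθ0 hT hK hf (M := C * (4 * s k) ^ a) (by positivity)
      hsk hsk1 hR hFR (fun y hy => hF y hy _ (by positivity) (by linarith)) hk1).trans ?_
    rw [add_mul (3 ^ d * C * 4 ^ a)]
    apply add_le_add
    · apply le_of_eq
      rw [Real.mul_rpow (by norm_num) hsk.le, hsdef]
      simp only
      rw [← Real.rpow_mul hk0.le]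
      have : -p * a = -2 := by rw [hp]; field_simp
      rw [this]; ring
    · have e1 : (1 + K / s k) ≤ (1 + K) * (k : ℝ) ^ p := by
        have : (s k)⁻¹ = (k : ℝ) ^ p := by
          rw [hsdef]; simp only; rw [Real.rpow_neg hk0.le, inv_inv]
        rw [div_eq_mul_inv, this]
        have : 1 ≤ (k : ℝ) ^ p := Real.one_le_rpow hk1' hp0.le
        linarith
      have e2 : (s k ^ d)⁻¹ = (k : ℝ) ^ (p * d) := by
        rw [hsdef]; simp only
        rw [← Real.rpow_natCast, ← Real.rpow_mul hk0.le, ← Real.rpow_neg hk0.le]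
        congr 1; ring
      have e3 : θ k ≤ (k : ℝ) ^ (-P) := by
        rw [Real.rpow_neg hk0.le, ← one_div, le_div_iff₀ (Real.rpow_pos_of_pos hk0 _)]
        exact hk3
      have e4 : (k : ℝ) ^ p * (k : ℝ) ^ (-P) * (k : ℝ) ^ (p * d) = (k : ℝ) ^ (-2 : ℝ) := by
        rw [← Real.rpow_add hk0, ← Real.rpow_add hk0]
        congr 1; rw [hP]; ring
      rw [div_eq_mul_inv, e2]
      calc (R + 2) ^ d * ((1 + K / s k) * θ k) * (k : ℝ) ^ (p * d)
          ≤ (R + 2) ^ d * (((1 + K) * (k : ℝ) ^ p) * (k : ℝ) ^ (-P)) * (k : ℝ) ^ (p * d) := by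
            have := mul_le_mul e1 e3 (hθ0 k) (by positivity)
            gcongr
        _ = (R + 2) ^ d * (1 + K) * ((k : ℝ) ^ p * (k : ℝ) ^ (-P) * (k : ℝ) ^ (p * d)) := by ring
        _ = _ := by rw [e4]
  have hsum : Summable fun k : ℕ => μ.real {x | f x ∈ F ∧ dist (f (T^[k] x)) (f x) < s k} :=
    Summable.of_norm_bounded_eventually_nat
      ((Real.summable_nat_rpow.2 (by norm_num)).mul_left _) hbound
  have hBC : ∀ᵐ x ∂μ, ∀ᶠ k in atTop, x ∉ {x | f x ∈ F ∧ dist (f (T^[k] x)) (f x) < s k} := by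
    refine ae_eventually_notMem ?_
    have := hsum.tsum_ofReal_ne_top
    refine ne_of_eq_of_ne (tsum_congr fun k => ?_) this
    exact (ofReal_measureReal).symm
  have haper' : ∀ᵐ x ∂μ, ¬ ∃ n : ℕ, 1 ≤ n ∧ f (T^[n] x) = f x := measure_eq_zero_iff_ae_notMem.1 haper
  filter_upwards [hBC, haper'] with x hx hxa hxF
  -- Borel–Cantelli controls all large `k`; aperiodicity makes the finitely many remaining distances
  -- positive.
  obtain ⟨c, hc, hck⟩ := exists_pos_le_of_eventually_one_le
    (g := fun k => dist (f (T^[k] x)) (f x) * (k : ℝ) ^ p)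
    (fun k hk => by
      have hk0 : (0 : ℝ) < k := by exact_mod_cast hk
      have : 0 < dist (f (T^[k] x)) (f x) := dist_pos.2 fun e => hxa ⟨k, hk, e⟩
      positivity)
    (by
      filter_upwards [hx, eventually_ge_atTop 1] with k hk hk1
      have hk0 : (0 : ℝ) < k := by exact_mod_cast hk1
      have : s k ≤ dist (f (T^[k] x)) (f x) := not_lt.1 fun hlt => hk ⟨hxF, hlt⟩
      rw [hsdef] at this
      simp only at this
      rwa [Real.rpow_neg hk0.le, ← one_div, div_le_iff₀ (Real.rpow_pos_of_pos hk0 _)] at this)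
  refine ⟨c, hc, fun k hk => ?_⟩
  have hk0 : (0 : ℝ) < k := by exact_mod_cast hk
  rw [Real.rpow_neg hk0.le, ← div_eq_mul_inv, div_le_iff₀ (Real.rpow_pos_of_pos hk0 _)]
  exact hck k hk

end ShortReturns

/-! ### Differentiation of measures on small balls. -/

lemma measure_ball_le_of_closedBall {Y : Type*} [PseudoMetricSpace Y] [MeasurableSpace Y]
    {ρ ν : Measure Y} {y : Y} {ε : ℝ≥0∞}
    (h : ∀ᶠ r in 𝓝[>] (0 : ℝ), ρ (Metric.closedBall y r) ≤ ε * ν (Metric.closedBall y r)) :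
    ∀ᶠ r in 𝓝[>] (0 : ℝ), ρ (Metric.ball y r) ≤ ε * ν (Metric.ball y r) := by
  obtain ⟨u, hu, hu'⟩ := mem_nhdsGT_iff_exists_Ioo_subset.1 h
  filter_upwards [Ioo_mem_nhdsGT hu] with r hr
  -- The differentiation theorem concerns closed balls; an open ball is the increasing union of
  -- closed balls of smaller radii, where the same bound holds.
  obtain ⟨v, hv, hvr, hlim⟩ := exists_seq_strictMono_tendsto' hr.1
  have hball : Metric.ball y r = ⋃ n, Metric.closedBall y (v n) := by
    ext z
    simp only [Metric.mem_ball, Set.mem_iUnion, Metric.mem_closedBall]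
    constructor
    · intro hz
      obtain ⟨n, hn⟩ := (hlim.eventually_const_lt hz).exists
      exact ⟨n, hn.le⟩
    · rintro ⟨n, hn⟩
      exact hn.trans_lt (hvr n).2
  have hmono : Monotone fun n => Metric.closedBall y (v n) :=
    fun i j hij => Metric.closedBall_subset_closedBall (hv.monotone hij)
  rw [hball, hmono.measure_iUnion]
  refine iSup_le fun n => ?_
  have h1 : ρ (Metric.closedBall y (v n)) ≤ ε * ν (Metric.closedBall y (v n)) :=
    hu' ⟨(hvr n).1, (hvr n).2.trans hr.2⟩
  exact h1.trans (mul_le_mul_right (measure_mono (Set.subset_iUnion _ n)) _)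

section Density

variable {E : Type*} [NormedAddCommGroup E] [InnerProductSpace ℝ E]
  [FiniteDimensional ℝ E] [MeasurableSpace E] [BorelSpace E]

/-- The measure of a ball is almost everywhere at least of the order of its volume. -/
lemma ae_exists_rpow_le_measureReal_ball (ν : Measure E) [IsFiniteMeasure ν] :
    ∀ᵐ y ∂ν, ∃ c : ℝ, 0 < c ∧ ∀ᶠ r in 𝓝[>] (0 : ℝ),
      c * r ^ (Module.finrank ℝ E : ℝ) ≤ ν.real (Metric.ball y r) := by
  -- Volume is differentiated with respect to `ν`, not conversely: this density is finite `ν`-almost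
  -- everywhere even when `ν` is singular.
  filter_upwards [Besicovitch.ae_tendsto_rnDeriv (volume : Measure E) ν,
    Measure.rnDeriv_lt_top (volume : Measure E) ν] with y hy hfin
  set v : ℝ := volume.real (Metric.ball (0 : E) 1)
  have hv : 0 < v := ENNReal.toReal_pos (Metric.measure_ball_pos _ _ one_pos).ne' measure_ball_lt_top.ne
  obtain ⟨C, hC1, hC2⟩ := ENNReal.lt_iff_exists_nnreal_btwn.1 hfin
  have hC0 : (0 : ℝ) < C := by
    have : (0 : ℝ≥0∞) < C := (zero_le).trans_lt hC1
    exact_mod_cast this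
  refine ⟨v / C, by positivity, ?_⟩
  have key : ∀ᶠ r in 𝓝[>] (0 : ℝ), volume (Metric.closedBall y r)
      ≤ C * ν (Metric.closedBall y r) := by
    filter_upwards [hy.eventually_lt_const hC1] with r hr
    exact (ENNReal.div_le_iff_le_mul (.inr ENNReal.coe_ne_top)
      (.inl (measure_ne_top _ _))).1 hr.le
  filter_upwards [measure_ball_le_of_closedBall key, self_mem_nhdsWithin] with r hr (hr0 : 0 < r)
  rw [Measure.addHaar_ball_of_pos _ _ hr0] at hr
  have := ENNReal.toReal_mono (by finiteness) hr
  rw [ENNReal.toReal_mul, ENNReal.toReal_mul, ENNReal.toReal_ofReal (by positivity),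
    ENNReal.coe_toReal] at this
  rw [Real.rpow_natCast, div_mul_eq_mul_div, div_le_iff₀ hC0, mul_comm v, mul_comm _ (C : ℝ)]
  exact this

/-- If the decreasing sets `Z j` exhaust no mass above `F`, then at almost every point of `F`
their relative weight in small balls is eventually arbitrarily small. -/
lemma ae_eventually_measure_inter_preimage_ball_le {X : Type*} [MeasurableSpace X]
    (μ : Measure X) [IsFiniteMeasure μ] {f : X → E} (hf : Measurable f) {F : Set E}
    (hF : MeasurableSet F) {Z : ℕ → Set X} (hZ : ∀ j, MeasurableSet (Z j)) (hanti : Antitone Z)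
    (hnull : μ (⋂ j, f ⁻¹' F ∩ Z j) = 0) :
    ∀ᵐ y ∂(μ.map f), y ∈ F → ∀ ε : ℝ≥0∞, 0 < ε → ε ≠ ∞ → ∃ j, ∀ᶠ r in 𝓝[>] (0 : ℝ),
      μ (f ⁻¹' Metric.ball y r ∩ Z j) ≤ ε * μ (f ⁻¹' Metric.ball y r) := by
  set ρ : ℕ → Measure E := fun j => (μ.restrict (Z j)).map f with hρ
  have hlim : Tendsto (fun j => ρ j F) atTop (𝓝 0) := by
    have : Tendsto (fun j => μ (f ⁻¹' F ∩ Z j)) atTop (𝓝 (μ (⋂ j, f ⁻¹' F ∩ Z j))) :=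
      tendsto_measure_iInter_atTop (fun j => ((hf hF).inter (hZ j)).nullMeasurableSet)
        (fun i j hij => Set.inter_subset_inter_right _ (hanti hij)) ⟨0, measure_ne_top _ _⟩
    rw [hnull] at this
    refine this.congr fun j => ?_
    rw [hρ, Measure.map_apply hf hF, Measure.restrict_apply (hf hF)]
  -- The infimum over `j` of the densities has integral over `F` at most every `ρ j F`, hence zero.
  have hinf : ∀ᵐ y ∂(μ.map f), y ∈ F → ⨅ j, (ρ j).rnDeriv (μ.map f) y = 0 := by
    have hz : ∫⁻ y in F, ⨅ j, (ρ j).rnDeriv (μ.map f) y ∂(μ.map f) = 0 := by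
      refine le_antisymm (ge_of_tendsto' hlim fun j => ?_) zero_le
      exact (lintegral_mono fun y => iInf_le _ j).trans (Measure.setLIntegral_rnDeriv_le F)
    exact (setLIntegral_eq_zero_iff hF
      (.iInf fun j => Measure.measurable_rnDeriv _ _)).1 hz
  filter_upwards [hinf, ae_all_iff.2 fun j => Besicovitch.ae_tendsto_rnDeriv (ρ j) (μ.map f)]
    with y hy hB hyF ε hε hε'
  obtain ⟨j, hj⟩ := iInf_lt_iff.1 ((hy hyF).trans_lt hε)
  refine ⟨j, ?_⟩
  have key : ∀ᶠ r in 𝓝[>] (0 : ℝ), ρ j (Metric.closedBall y r)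
      ≤ ε * (μ.map f) (Metric.closedBall y r) := by
    filter_upwards [(hB j).eventually_lt_const hj] with r hr
    exact (ENNReal.div_le_iff_le_mul (.inr hε') (.inl (measure_ne_top _ _))).1 hr.le
  filter_upwards [measure_ball_le_of_closedBall key] with r hr
  have hb : MeasurableSet (Metric.ball y r) := Metric.isOpen_ball.measurableSet
  rwa [hρ, Measure.map_apply hf hb, Measure.restrict_apply (hf hb), Measure.map_apply hf hb] at hr

end Density

/-! ### Rarity of short returns to balls. -/

section ShortReturnLaw

variable {X : Type*} [MetricSpace X] [MeasurableSpace X] [BorelSpace X] {μ : Measure X}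
  [IsProbabilityMeasure μ] {T : X → X} {E : Type*} [NormedAddCommGroup E] [InnerProductSpace ℝ E]
  [FiniteDimensional ℝ E] [MeasurableSpace E] [BorelSpace E] {f : X → E} {K : ℝ} {θ : ℕ → ℝ}

/-- Returns to small balls before a small negative power of the radius have conditional
probability tending to zero. -/
lemma CorrelationBound.ae_tendsto_short_return (h : CorrelationBound μ T θ)
    (hθ0 : ∀ n, 0 ≤ θ n)
    (hθ : ∀ p : ℝ, 0 < p → Tendsto (fun n : ℕ => θ n * (n : ℝ) ^ p) atTop (𝓝 0))
    (hT : Measurable T) (hK : 0 ≤ K) (hf : LipschitzWith (Real.toNNReal K) f)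
    (haper : AlmostAperiodic μ T f) {F : Set E} (hFm : MeasurableSet F) {R C a s₀ : ℝ}
    (hC : 0 ≤ C) (ha : 0 < a)
    (hs₀ : 0 < s₀) (hR : 0 ≤ R) (hFR : ∀ y ∈ F, ‖y‖ ≤ R)
    (hF : ∀ y ∈ F, ∀ s, 0 < s → s < s₀ → (μ.map f).real (Metric.ball y s) ≤ C * s ^ a)
    {δ : ℝ} (hδa : 2 / a * δ < 1) :
    ∀ᵐ y ∂(μ.map f), y ∈ F → Tendsto (fun r : ℝ =>
      μ.real (f ⁻¹' Metric.ball y r \ avoid T (f ⁻¹' Metric.ball y r) ⌊r ^ (-δ)⌋₊)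
        / μ.real (f ⁻¹' Metric.ball y r)) (𝓝[>] 0) (𝓝 0) := by
  have hfm : Measurable f := hf.continuous.measurable
  set p := 2 / a with hp
  -- `Z j` collects the points violating the polynomial lower bound with constant `1 / (j + 1)`; a
  -- point lying in every `Z j` admits no positive constant.
  set Z : ℕ → Set X := fun j => ⋃ k ∈ {k : ℕ | 1 ≤ k},
    {x | dist (f (T^[k] x)) (f x) < 1 / ((j : ℝ) + 1) * (k : ℝ) ^ (-p)} with hZdef
  have hZm : ∀ j, MeasurableSet (Z j) := fun j =>
    .biUnion (Set.to_countable _) fun k _ =>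
      measurableSet_lt ((hfm.comp (hT.iterate k)).dist hfm) measurable_const
  have hanti : Antitone Z := by
    intro i j hij x hx
    simp only [hZdef, Set.mem_iUnion, Set.mem_ofPred_eq] at hx ⊢
    obtain ⟨k, hk, hx⟩ := hx
    refine ⟨k, hk, lt_of_lt_of_le hx ?_⟩
    have : 1 / ((j : ℝ) + 1) ≤ 1 / ((i : ℝ) + 1) := Nat.one_div_le_one_div hij
    exact mul_le_mul_of_nonneg_right this (Real.rpow_nonneg (Nat.cast_nonneg k) _)
  have hnull : μ (⋂ j, f ⁻¹' F ∩ Z j) = 0 := by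
    rw [measure_eq_zero_iff_ae_notMem]
    filter_upwards [h.ae_exists_le_dist hθ0 hθ hT hK hf haper hC ha hs₀ hR hFR hF] with x hx hmem
    rw [Set.mem_iInter] at hmem
    obtain ⟨c, hc, hck⟩ := hx (hmem 0).1
    obtain ⟨j, hj⟩ := exists_nat_one_div_lt hc
    have := (hmem j).2
    simp only [hZdef, Set.mem_iUnion] at this
    obtain ⟨k, hk, hx⟩ := this
    have h1 := hck k hk
    have hx' : dist (f (T^[k] x)) (f x) < 1 / ((j : ℝ) + 1) * (k : ℝ) ^ (-p) := hx
    have h2 := mul_le_mul_of_nonneg_right hj.le (Real.rpow_nonneg (Nat.cast_nonneg k) (-p))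
    linarith
  filter_upwards [ae_eventually_measure_inter_preimage_ball_le μ hfm hFm hZm hanti hnull]
    with y hy hyF
  have hsub : ∀ j, ∀ᶠ r in 𝓝[>] (0 : ℝ),
      f ⁻¹' Metric.ball y r \ avoid T (f ⁻¹' Metric.ball y r) ⌊r ^ (-δ)⌋₊
        ⊆ f ⁻¹' Metric.ball y r ∩ Z j := by
    intro j
    have h1 := (tendsto_rpow_nhdsGT_zero' (sub_pos.2 hδa)).const_mul (2 * ((j : ℝ) + 1))
    rw [mul_zero] at h1
    filter_upwards [h1.eventually_lt_const one_pos, self_mem_nhdsWithin] with r hr (hr0 : 0 < r)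
    rintro x ⟨hxA, hx⟩
    refine ⟨hxA, ?_⟩
    simp only [avoid, Set.mem_ofPred_eq, not_forall, not_not] at hx
    obtain ⟨k, hk1, hk2, hk3⟩ := hx
    simp only [hZdef, Set.mem_iUnion]
    refine ⟨k, hk1, ?_⟩
    have hk0 : (0 : ℝ) < k := by exact_mod_cast hk1
    have hkr : (k : ℝ) ≤ r ^ (-δ) :=
      (Nat.le_floor_iff (Real.rpow_nonneg hr0.le _)).1 hk2
    have hd : dist (f (T^[k] x)) (f x) < 2 * r := by
      have a1 : dist (f (T^[k] x)) y < r := hk3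
      have a2 : dist (f x) y < r := hxA
      linarith [dist_triangle_right (f (T^[k] x)) (f x) y]
    have hkp : r ^ (p * δ) ≤ (k : ℝ) ^ (-p) := by
      have hp0 : 0 < p := by positivity
      have := Real.rpow_le_rpow_of_nonpos hk0 hkr (neg_nonpos.2 hp0.le)
      rw [← Real.rpow_mul hr0.le] at this
      rwa [neg_mul_neg, mul_comm δ] at this
    -- Here `p * δ < 1` is used: `r` is negligible against `r ^ (p * δ)`, which in turn is at most
    -- `k ^ (-p)` for `k ≤ r ^ (-δ)`.
    have hr2 : 2 * r < 1 / ((j : ℝ) + 1) * r ^ (p * δ) := by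
      have e : r ^ (1 - p * δ) * r ^ (p * δ) = r := by
        rw [← Real.rpow_add hr0]; simp
      have hq : 0 < r ^ (p * δ) := Real.rpow_pos_of_pos hr0 _
      have := mul_lt_mul_of_pos_right hr hq
      rw [mul_assoc, e] at this
      rw [one_div, inv_mul_eq_div, lt_div_iff₀ (by positivity)]
      linarith
    have hj0 : (0 : ℝ) ≤ 1 / ((j : ℝ) + 1) := by positivity
    exact (hd.trans hr2).trans_le (mul_le_mul_of_nonneg_left hkp hj0)
  rw [Metric.tendsto_nhds]
  intro ε hε
  obtain ⟨j, hj⟩ := hy hyF (ENNReal.ofReal (ε / 2)) (by simpa using hε) ENNReal.ofReal_ne_top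
  filter_upwards [hj, hsub j] with r hr hs
  have hnn : 0 ≤ μ.real (f ⁻¹' Metric.ball y r \
      avoid T (f ⁻¹' Metric.ball y r) ⌊r ^ (-δ)⌋₊) / μ.real (f ⁻¹' Metric.ball y r) := by
    positivity
  rw [Real.dist_0_eq_abs, abs_of_nonneg hnn]
  refine lt_of_le_of_lt (div_le_of_le_mul₀ measureReal_nonneg (by positivity) ?_) (half_lt_self hε)
  have h1 := (measure_mono hs).trans hr
  have h2 := ENNReal.toReal_mono (by finiteness) h1
  rwa [ENNReal.toReal_mul, ENNReal.toReal_ofReal (by positivity)] at h2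

end ShortReturnLaw

/-! ### Power bounds from positive lower dimension. -/

lemma exists_measureReal_ball_le_rpow {Y : Type*} [PseudoMetricSpace Y] [MeasurableSpace Y]
    {ν : Measure Y} {y : Y} (h : 0 < lowerLocalDim ν y) :
    ∃ a : ℝ, 0 < a ∧ ∀ᶠ r in 𝓝[>] (0 : ℝ), ν.real (Metric.ball y r) ≤ r ^ a := by
  obtain ⟨a, ha0, ha⟩ := EReal.lt_iff_exists_real_btwn.1 h
  refine ⟨a, by exact_mod_cast ha0, ?_⟩
  filter_upwards [eventually_lt_of_lt_liminf ha, Ioo_mem_nhdsGT (zero_lt_one (α := ℝ))]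
    with r hr hr01
  have hL : Real.log r < 0 := Real.log_neg hr01.1 hr01.2
  have hlog : ENNReal.log (ν (Metric.ball y r)) ≤ ((a * Real.log r : ℝ) : EReal) := by
    by_contra! hc
    have hLe : ((Real.log r : ℝ) : EReal) ≤ 0 := by exact_mod_cast hL.le
    have := EReal.div_le_div_right_of_nonpos hLe hc.le
    rw [← EReal.coe_div, mul_div_cancel_right₀ _ hL.ne] at this
    exact absurd hr (not_lt.2 this)
  have e : ENNReal.log (ENNReal.ofReal (r ^ a)) = ((a * Real.log r : ℝ) : EReal) := by
    rw [ENNReal.log_ofReal_of_pos (Real.rpow_pos_of_pos hr01.1 a), Real.log_rpow hr01.1]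
  rw [← e, ENNReal.log_le_log_iff] at hlog
  exact ENNReal.toReal_le_of_le_ofReal (Real.rpow_nonneg hr01.1.le a) hlog

/-! ### Mixing error relative to the measure of the ball. -/

section

variable {X : Type*} [MetricSpace X] [MeasurableSpace X] [BorelSpace X] {μ : Measure X}
  [IsProbabilityMeasure μ] {T : X → X} {θ : ℕ → ℝ} {K : ℝ}

lemma CorrelationBound.exists_mixing_rate {Y : Type*} [PseudoMetricSpace Y] [MeasurableSpace Y]
    [BorelSpace Y] {f : X → Y} (h : CorrelationBound μ T θ)
    (hθ0 : ∀ n, 0 ≤ θ n)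
    (hθ : ∀ p : ℝ, 0 < p → Tendsto (fun n : ℕ => θ n * (n : ℝ) ^ p) atTop (𝓝 0))
    (hK : 0 ≤ K) (hf : LipschitzWith (Real.toNNReal K) f) {y : Y} {a b r₀ c d δ : ℝ}
    (ha : 0 < a) (hb : 0 ≤ b) (hr₀ : 0 < r₀)
    (hann : ∀ r ρ : ℝ, 0 < ρ → ρ < r → r < r₀ →
      (μ.map f) (Metric.ball y r \ Metric.ball y (r - ρ)) ≤ ENNReal.ofReal (r ^ (-b) * ρ ^ a))
    (hc : 0 < c) (hd : 0 ≤ d)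
    (hlow : ∀ᶠ r in 𝓝[>] (0 : ℝ), c * r ^ d ≤ μ.real (f ⁻¹' Metric.ball y r)) (hδ : 0 < δ) :
    ∃ κ : ℝ → ℝ, (∀ᶠ r in 𝓝[>] (0 : ℝ), ∀ S, MeasurableSet S →
        |μ.real (f ⁻¹' Metric.ball y r ∩ T^[⌊r ^ (-δ)⌋₊] ⁻¹' S)
          - μ.real (f ⁻¹' Metric.ball y r) * μ.real S| ≤ κ r) ∧
      Tendsto (fun r => κ r / μ.real (f ⁻¹' Metric.ball y r)) (𝓝[>] 0) (𝓝 0) := by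
  -- The annulus has width `r ^ q`. Its bound `r ^ (-b + q * a)`, divided by `c * r ^ d`, is a
  -- multiple of `r ^ (1 + 2 * a)`; the summand `2` ensures `q > 1`, hence `r ^ q < r` for `r < 1`.
  set q : ℝ := (b + d + 1) / a + 2 with hq
  have hq1 : 1 < q := by
    have : 0 ≤ (b + d + 1) / a := by positivity
    linarith
  refine ⟨fun r => r ^ (-b) * (r ^ q) ^ a + (1 + K / r ^ q) * θ ⌊r ^ (-δ)⌋₊, ?_, ?_⟩
  · filter_upwards [Ioo_mem_nhdsGT hr₀, Ioo_mem_nhdsGT (zero_lt_one (α := ℝ)),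
      (tendsto_natFloor_rpow_neg hδ).eventually_ge_atTop 1] with r hr hr01 hn S hS
    have hρ : 0 < r ^ q := Real.rpow_pos_of_pos hr.1 q
    have hρr : r ^ q < r := by
      simpa using Real.rpow_lt_rpow_of_exponent_gt hr.1 hr01.2 hq1
    refine (h.abs_measureReal_inter_sub_le hK hf y r hρ hS hn).trans ?_
    gcongr
    have hr0 := hr.1
    exact ENNReal.toReal_le_of_le_ofReal (by positivity) (hann r _ hρ hρr hr.2)
  · have t1 := (tendsto_rpow_nhdsGT_zero' (by positivity : 0 < 1 + 2 * a)).const_mul (1 / c)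
    have t2 := (tendsto_rpow_neg_mul_superPoly hθ0 hθ hδ (by positivity : 0 < q + d)).const_mul
      ((1 + K) / c)
    have t := t1.add t2
    rw [mul_zero, mul_zero, add_zero] at t
    refine squeeze_zero' ?_ ?_ t
    · filter_upwards [self_mem_nhdsWithin] with r (hr : 0 < r)
      have := hθ0 ⌊r ^ (-δ)⌋₊
      positivity
    · filter_upwards [hlow, Ioo_mem_nhdsGT (zero_lt_one (α := ℝ))] with r hl hr
      have hr0 : 0 < r := hr.1
      have hθn := hθ0 ⌊r ^ (-δ)⌋₊
      have hrq : 1 ≤ r ^ (-q) :=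
        Real.one_le_rpow_of_pos_of_le_one_of_nonpos hr0 hr.2.le (by linarith)
      have e0 : K / r ^ q = K * r ^ (-q) := by rw [Real.rpow_neg hr0.le, div_eq_mul_inv]
      have e1 : 1 + K / r ^ q ≤ (1 + K) * r ^ (-q) := by rw [e0]; linarith
      have e2 : r ^ (-b) * (r ^ q) ^ a * r ^ (-d) = r ^ (1 + 2 * a) := by
        rw [← Real.rpow_mul hr0.le, ← Real.rpow_add hr0, ← Real.rpow_add hr0]
        congr 1
        rw [hq]
        field_simp
        ring
      have e3 : r ^ (-q) * r ^ (-d) = r ^ (-(q + d)) := by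
        rw [← Real.rpow_add hr0]; congr 1; ring
      have hnum : 0 ≤ r ^ (-b) * (r ^ q) ^ a + (1 + K / r ^ q) * θ ⌊r ^ (-δ)⌋₊ := by positivity
      have hcr : 0 < c * r ^ d := by positivity
      calc _ ≤ (r ^ (-b) * (r ^ q) ^ a + (1 + K / r ^ q) * θ ⌊r ^ (-δ)⌋₊) / (c * r ^ d) :=
            div_le_div_of_nonneg_left hnum hcr hl
        _ = 1 / c * (r ^ (-b) * (r ^ q) ^ a * r ^ (-d))
            + (1 + K / r ^ q) * θ ⌊r ^ (-δ)⌋₊ * (r ^ (-d) / c) := by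
          rw [Real.rpow_neg hr0.le d]
          field_simp
        _ ≤ 1 / c * (r ^ (-b) * (r ^ q) ^ a * r ^ (-d))
            + (1 + K) * r ^ (-q) * θ ⌊r ^ (-δ)⌋₊ * (r ^ (-d) / c) := by gcongr
        _ = 1 / c * r ^ (1 + 2 * a) + (1 + K) / c * (r ^ (-(q + d)) * θ ⌊r ^ (-δ)⌋₊) := by
          rw [e2, ← e3]; ring

end

/-! ### Exhaustion by closed sets with uniform upper bounds. -/

section UpperRegular

variable {E : Type*} [NormedAddCommGroup E] [MeasurableSpace E]

/-- The closure of the bounded set of points where `ν` has balls of measure at most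
`s ^ (1 / (m + 1))`, at all scales `s < 1 / (m + 1)`. -/
def upperRegularSet (ν : Measure E) (m : ℕ) : Set E :=
  closure {y | ‖y‖ ≤ (m : ℝ) + 1 ∧ ∀ s : ℝ, 0 < s → s < 1 / ((m : ℝ) + 1) →
    ν.real (Metric.ball y s) ≤ s ^ (1 / ((m : ℝ) + 1))}

lemma norm_le_of_mem_upperRegularSet {ν : Measure E} {m : ℕ} {y : E}
    (hy : y ∈ upperRegularSet ν m) : ‖y‖ ≤ (m : ℝ) + 1 := by
  have : upperRegularSet ν m ⊆ Metric.closedBall 0 ((m : ℝ) + 1) :=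
    closure_minimal (fun z hz => mem_closedBall_zero_iff.2 hz.1) Metric.isClosed_closedBall
  exact mem_closedBall_zero_iff.1 (this hy)

/-- Taking the closure makes the set measurable and costs only a doubling of the radius: approximate
by a point at distance less than `s`. -/
lemma measureReal_ball_le_of_mem_upperRegularSet {ν : Measure E} [IsFiniteMeasure ν] {m : ℕ}
    {y : E} (hy : y ∈ upperRegularSet ν m) {s : ℝ} (hs : 0 < s)
    (hs' : s < 1 / (2 * ((m : ℝ) + 1))) :
    ν.real (Metric.ball y s) ≤ 2 ^ (1 / ((m : ℝ) + 1)) * s ^ (1 / ((m : ℝ) + 1)) := by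
  obtain ⟨z, hz, hyz⟩ := Metric.mem_closure_iff.1 hy s hs
  rw [← Real.mul_rpow (by norm_num) hs.le]
  refine (measureReal_mono (Metric.ball_subset_ball' (ε₂ := 2 * s) ?_)).trans
    (hz.2 (2 * s) (by positivity) ?_)
  · linarith
  · rw [lt_div_iff₀ (by positivity)] at hs' ⊢
    linarith

lemma exists_mem_upperRegularSet {ν : Measure E} {y : E} (h : 0 < lowerLocalDim ν y) :
    ∃ m, y ∈ upperRegularSet ν m := by
  obtain ⟨a, ha, hev⟩ := exists_measureReal_ball_le_rpow h
  obtain ⟨u, hu, hu'⟩ := mem_nhdsGT_iff_exists_Ioo_subset.1 hev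
  obtain ⟨m₁, hm₁⟩ := exists_nat_one_div_lt (lt_min ha hu)
  obtain ⟨m₂, hm₂⟩ := exists_nat_ge ‖y‖
  refine ⟨max m₁ m₂, subset_closure ⟨?_, fun s hs hs' => ?_⟩⟩
  · have : (m₂ : ℝ) ≤ (max m₁ m₂ : ℕ) := by exact_mod_cast le_max_right _ _
    linarith
  · have h1 : 1 / (((max m₁ m₂ : ℕ) : ℝ) + 1) ≤ 1 / ((m₁ : ℝ) + 1) :=
      Nat.one_div_le_one_div (le_max_left _ _)
    have h2 := h1.trans hm₁.le
    have h3 : (1 : ℝ) / (((max m₁ m₂ : ℕ) : ℝ) + 1) ≤ 1 := by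
      rw [div_le_one (by positivity)]
      linarith [Nat.cast_nonneg (α := ℝ) (max m₁ m₂)]
    have h4 : ν.real (Metric.ball y s) ≤ s ^ a :=
      hu' ⟨hs, hs'.trans_le (h2.trans (min_le_right _ _))⟩
    exact h4.trans (Real.rpow_le_rpow_of_exponent_ge hs (hs'.le.trans h3)
      (h2.trans (min_le_left _ _)))

end UpperRegular

end ObsHitting

/-! ### Assembly of the theorem. -/

open ObsHitting in
theorem theorem2 {X : Type*} [MetricSpace X] [MeasurableSpace X] [BorelSpace X]
    (μ : Measure X) [IsProbabilityMeasure μ] (T : X → X) (hT : MeasurePreserving T μ μ)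
    (hdecay : ObsHitting.SuperPolyDecay μ T)
    (N : ℕ) (f : X → EuclideanSpace ℝ (Fin N)) (hf : ∃ K, LipschitzWith K f)
    (haper : ObsHitting.AlmostAperiodic μ T f)
    (hann : ObsHitting.AnnulusCondition (μ.map f)) (t : ℝ) (ht : 0 ≤ t) :
    ∀ᵐ x₀ ∂μ, 0 < ObsHitting.lowerLocalDim (μ.map f) (f x₀) →
      Tendsto (fun r : ℝ => μ.real
          {x | ENNReal.ofReal t / (μ.map f) (Metric.ball (f x₀) r)
            < (ObsHitting.hittingTime T f (Metric.ball (f x₀) r) x : ℝ≥0∞)})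
        (𝓝[>] 0) (𝓝 (Real.exp (-t))) ∧
      Tendsto (fun r : ℝ =>
          (ProbabilityTheory.cond μ (f ⁻¹' Metric.ball (f x₀) r)).real
          {x | ENNReal.ofReal t / (μ.map f) (Metric.ball (f x₀) r)
            < (ObsHitting.hittingTime T f (Metric.ball (f x₀) r) x : ℝ≥0∞)})
        (𝓝[>] 0) (𝓝 (Real.exp (-t))) := by
  obtain ⟨K₀, hK₀⟩ := hf
  obtain ⟨θ, hθ0, hθ, hcorr⟩ := hdecay.exists_correlationBound hT.measurable
  have hfm : Measurable f := hK₀.continuous.measurable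
  have hK : (0 : ℝ) ≤ K₀ := K₀.coe_nonneg
  have hfK : LipschitzWith (Real.toNNReal (K₀ : ℝ)) f := by rwa [Real.toNNReal_coe]
  have : IsProbabilityMeasure (μ.map f) := Measure.isProbabilityMeasure_map hfm.aemeasurable
  have hball : ∀ y r, MeasurableSet (f ⁻¹' Metric.ball y r) :=
    fun y r => hfm Metric.isOpen_ball.measurableSet
  have hmap : ∀ y r, (μ.map f) (Metric.ball y r) = μ (f ⁻¹' Metric.ball y r) :=
    fun y r => Measure.map_apply hfm Metric.isOpen_ball.measurableSet
  -- With `a = 1 / (m + 1)`, the choice `δ = a / 4` gives `2 / a * δ = 1 / 2 < 1`, and also `δ < a`,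
  -- which makes the gap times the measure of the ball vanish. Only countably many `m` occur, so the
  -- exceptional sets can be discarded together.
  have hshort : ∀ m : ℕ, ∀ᵐ y ∂(μ.map f), y ∈ upperRegularSet (μ.map f) m →
      Tendsto (fun r : ℝ => μ.real (f ⁻¹' Metric.ball y r \
          avoid T (f ⁻¹' Metric.ball y r) ⌊r ^ (-(1 / (4 * ((m : ℝ) + 1))))⌋₊)
        / μ.real (f ⁻¹' Metric.ball y r)) (𝓝[>] 0) (𝓝 0) := fun m =>
    hcorr.ae_tendsto_short_return hθ0 hθ hT.measurable hK hfK haper isClosed_closure.measurableSet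
      (R := (m : ℝ) + 1) (C := 2 ^ (1 / ((m : ℝ) + 1))) (a := 1 / ((m : ℝ) + 1))
      (s₀ := 1 / (2 * ((m : ℝ) + 1))) (by positivity) (by positivity) (by positivity)
      (by positivity) (fun y hy => norm_le_of_mem_upperRegularSet hy)
      (fun y hy s hs hs' => measureReal_ball_le_of_mem_upperRegularSet hy hs hs')
      (by
        have : (0 : ℝ) < (m : ℝ) + 1 := by positivity
        field_simp
        norm_num)
  filter_upwards [ae_of_ae_map hfm.aemeasurable hann,
    ae_of_ae_map hfm.aemeasurable (ae_exists_rpow_le_measureReal_ball (μ.map f)),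
    ae_of_ae_map hfm.aemeasurable (ae_all_iff.2 hshort)] with x₀ h₁ h₂ h₃ hdim
  obtain ⟨a, b, ha, hb, r₀, hr₀, hann⟩ := h₁
  obtain ⟨c, hc, hlow⟩ := h₂
  obtain ⟨m, hm⟩ := exists_mem_upperRegularSet hdim
  have hreal : ∀ r, (μ.map f).real (Metric.ball (f x₀) r) = μ.real (f ⁻¹' Metric.ball (f x₀) r) :=
    fun r => by rw [measureReal_def, hmap, measureReal_def]
  simp only [hreal] at hlow
  set δ : ℝ := 1 / (4 * ((m : ℝ) + 1)) with hδdef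
  have hδ : 0 < δ := by positivity
  obtain ⟨κ, hκ, hκ0⟩ := hcorr.exists_mixing_rate hθ0 hθ hK hfK ha hb hr₀ hann hc
    (Nat.cast_nonneg _) hlow hδ
  have hup : ∀ᶠ r in 𝓝[>] (0 : ℝ), μ.real (f ⁻¹' Metric.ball (f x₀) r)
      ≤ 2 ^ (1 / ((m : ℝ) + 1)) * r ^ (1 / ((m : ℝ) + 1)) := by
    filter_upwards [Ioo_mem_nhdsGT (by positivity : 0 < 1 / (2 * ((m : ℝ) + 1)))] with r hr
    rw [← hreal]
    exact measureReal_ball_le_of_mem_upperRegularSet hm hr.1 hr.2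
  have hpos : ∀ᶠ r in 𝓝[>] (0 : ℝ), 0 < μ.real (f ⁻¹' Metric.ball (f x₀) r) := by
    filter_upwards [hlow, self_mem_nhdsWithin] with r hr (hr0 : 0 < r)
    exact lt_of_lt_of_le (by positivity) hr
  have hA0 : Tendsto (fun r => μ.real (f ⁻¹' Metric.ball (f x₀) r)) (𝓝[>] 0) (𝓝[>] 0) := by
    refine tendsto_nhdsWithin_iff.2 ⟨?_, hpos⟩
    have h := (tendsto_rpow_nhdsGT_zero' (by positivity : 0 < 1 / ((m : ℝ) + 1))).const_mul
      ((2 : ℝ) ^ (1 / ((m : ℝ) + 1)))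
    rw [mul_zero] at h
    exact squeeze_zero' (.of_forall fun _ => measureReal_nonneg) hup h
  have hn : Tendsto (fun r : ℝ => (⌊r ^ (-δ)⌋₊ : ℝ) * μ.real (f ⁻¹' Metric.ball (f x₀) r))
      (𝓝[>] 0) (𝓝 0) := by
    have hexp : 0 < -δ + 1 / ((m : ℝ) + 1) := by
      rw [hδdef]
      have : (0 : ℝ) < (m : ℝ) + 1 := by positivity
      field_simp
      norm_num
    have h := (tendsto_rpow_nhdsGT_zero' hexp).const_mul ((2 : ℝ) ^ (1 / ((m : ℝ) + 1)))
    rw [mul_zero] at h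
    refine squeeze_zero' (.of_forall fun _ => by positivity) ?_ h
    filter_upwards [hup, self_mem_nhdsWithin] with r hr (hr0 : 0 < r)
    calc _ ≤ r ^ (-δ) * (2 ^ (1 / ((m : ℝ) + 1)) * r ^ (1 / ((m : ℝ) + 1))) :=
          mul_le_mul (Nat.floor_le (by positivity)) hr measureReal_nonneg (by positivity)
      _ = _ := by rw [Real.rpow_add hr0]; ring
  have hlaw := tendsto_avoid_exp hT (A := fun r => f ⁻¹' Metric.ball (f x₀) r) (hball _) hA0
    hκ hκ0 (h₃ m hm) hn ht
  have hset : ∀ᶠ r in 𝓝[>] (0 : ℝ), avoid T (f ⁻¹' Metric.ball (f x₀) r)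
        ⌊t / μ.real (f ⁻¹' Metric.ball (f x₀) r)⌋₊
      = {x | ENNReal.ofReal t / (μ.map f) (Metric.ball (f x₀) r)
          < (hittingTime T f (Metric.ball (f x₀) r) x : ℝ≥0∞)} := by
    filter_upwards [hpos] with r hr
    have h0 : μ (f ⁻¹' Metric.ball (f x₀) r) ≠ 0 := fun h => by simp [measureReal_def, h] at hr
    rw [hmap, setOf_lt_hittingTime f _ (ENNReal.div_ne_top ENNReal.ofReal_ne_top h0),
      ENNReal.toReal_div, ENNReal.toReal_ofReal ht, measureReal_def]
  refine ⟨hlaw.1.congr' ?_, hlaw.2.congr' ?_⟩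
  · filter_upwards [hset] with r hr
    rw [hr]
  · filter_upwards [hset] with r hr
    rw [hr]
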